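/- Let $\omega>0$, $D_{pp},D_{qq}\ge 0$ and $D_{pq},\gamma\in\mathbb R$ satisfy the Lindblad condition $\Delta:=D_{pp}D_{qq}-D_{pq}^2-\gamma^2/4\ge 0$. Let $V:\mathbb R\to\mathbb R$ be twice differentiable with $|V'(x)|\le g_V(1+|x|^2)^{\alpha/2}$ for all $x\in\mathbb R$, for some constants $g_V>0$ and $0\le\alpha<1$. On $L^2(\mathbb R)=L^2(\mathbb R;\mathbb C)$ let $q$ be multiplication by $x$ and $p=-i\,d/dx$ (both on their maximal domains), and let $N=\frac12(p^2+q^2-1)$ with $\mathrm{Dom}(N)=\{u\in L^2(\mathbb R): p^2u,\ q^2u\in L^2(\mathbb R)\}$. Define on $\mathrm{Dom}(N)$ the operator $$G=-\Big(D_{qq}+\frac i2\Big)p^2-\Big(D_{pp}+\frac{i\omega^2}2\Big)q^2+\Big(D_{pq}-\frac{i\gamma}2\Big)(pq+qp)+\frac\gamma2-iV(q).$$ All terms are well defined in $L^2(\mathbb R)$ on the whole of $\mathrm{Dom}(N)$, and, if $D_{pp}>0$, $$G=-\tfrac12\,(L_1^*L_1+L_2^*L_2)-iH\quad\text{on }\mathrm{Dom}(N),$$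 where $H=\frac12\big(p^2+\omega^2q^2+\gamma(pq+qp)\big)+V(q)$, $L_1=\frac{-2D_{pq}+i\gamma}{\sqrt{2D_{pp}}}\,p+\sqrt{2D_{pp}}\,q$ and $L_2=\frac{2\sqrt\Delta}{\sqrt{2D_{pp}}}\,p$. Moreover $G$, with domain $\mathrm{Dom}(N)$, is a closed operator, and it is the infinitesimal generator of a strongly continuous semigroup $(P_t)_{t\ge0}$ of contractions on $L^2(\mathbb R)$. -/

import Mathlib

open MeasureTheory Filter Topology
open scoped NNReal ENNReal SchwartzMap

noncomputable section

namespace QFP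

/-- The Hilbert space `L²(ℝ)` of complex valued square integrable functions. -/
abbrev L2R : Type := Lp ℂ 2 (volume : Measure ℝ)

/-! ### Basic unbounded operators on `L²(ℝ)` -/

/-- The graph of the maximal operator of multiplication by `m`:
all pairs `(u, g)` of square integrable functions with `g = m u` almost everywhere. -/
def mulGraph (m : ℝ → ℝ) : Submodule ℂ (L2R × L2R) where
  carrier := {z | ∀ᵐ x : ℝ, z.2 x = (m x : ℂ) * z.1 x}
  zero_mem' := by
    change ∀ᵐ x : ℝ, (0 : L2R) x = (m x : ℂ) * (0 : L2R) x
    filter_upwards [Lp.coeFn_zero ℂ 2 (volume : Measure ℝ)] with x hx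
    rw [hx]
    simp
  add_mem' := by
    intro a b ha hb
    filter_upwards [ha, hb, Lp.coeFn_add a.1 b.1, Lp.coeFn_add a.2 b.2] with x h1 h2 h3 h4
    simp only [Prod.fst_add, Prod.snd_add, h3, h4, Pi.add_apply, h1, h2]
    ring
  smul_mem' := by
    intro c a ha
    filter_upwards [ha, Lp.coeFn_smul c a.1, Lp.coeFn_smul c a.2] with x h1 h3 h4
    simp only [Prod.smul_fst, Prod.smul_snd, h3, h4, Pi.smul_apply, h1, smul_eq_mul]
    ring

/-- The operator of multiplication by the real function `m` on its maximal domain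
`{u ∈ L² | m u ∈ L²}`. -/
def mulOp (m : ℝ → ℝ) : L2R →ₗ.[ℂ] L2R := (mulGraph m).toLinearPMap

theorem mem_graph_mulOp (m : ℝ → ℝ) (u g : L2R) :
    (u, g) ∈ (mulOp m).graph ↔ ∀ᵐ x : ℝ, g x = (m x : ℂ) * u x := by
  have h : ∀ z ∈ mulGraph m, z.1 = 0 → z.2 = 0 := by
    intro z hz h0
    apply Lp.ext
    have hz' : ∀ᵐ x : ℝ, z.2 x = (m x : ℂ) * z.1 x := hz
    filter_upwards [hz', Lp.coeFn_zero ℂ 2 (volume : Measure ℝ)] with x h1 h2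
    rw [h1, h0, h2]
    simp
  rw [mulOp, Submodule.toLinearPMap_graph_eq _ h]
  rfl

/-- The position operator `q`, multiplication by the coordinate. -/
def posOp : L2R →ₗ.[ℂ] L2R := mulOp (fun x => x)

/-- The embedding of `L²(ℝ)` into the tempered distributions. -/
abbrev toDistr : L2R →L[ℂ] 𝓢'(ℝ, ℂ) :=
  Lp.toTemperedDistributionCLM ℂ (volume : Measure ℝ) 2

/-- The graph of `-i d/dx`: all pairs `(u, g)` of square integrable functions with
`-i u' = g`, that is `u' = i g`, in the sense of (tempered) distributions. -/
def momGraph : Submodule ℂ (L2R × L2R) where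
  carrier := {z | TemperedDistribution.derivCLM ℂ (toDistr z.1) = toDistr (Complex.I • z.2)}
  zero_mem' := by
    change TemperedDistribution.derivCLM ℂ (toDistr 0) = toDistr (Complex.I • 0)
    rw [smul_zero, map_zero, map_zero]
  add_mem' := by
    intro a b ha hb
    change TemperedDistribution.derivCLM ℂ (toDistr (a.1 + b.1))
      = toDistr (Complex.I • (a.2 + b.2))
    rw [smul_add, map_add, map_add, map_add]
    exact congrArg₂ (· + ·) ha hb
  smul_mem' := by
    intro c a ha
    change TemperedDistribution.derivCLM ℂ (toDistr (c • a.1))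
      = toDistr (Complex.I • (c • a.2))
    rw [smul_comm, map_smul, map_smul, map_smul]
    exact congrArg (c • ·) ha

/-- The momentum operator `p = -i d/dx` on its maximal domain
`{u ∈ L² | u' ∈ L²}` (distributional derivative). -/
def momOp : L2R →ₗ.[ℂ] L2R := momGraph.toLinearPMap

theorem mem_graph_momOp (u g : L2R) :
    (u, g) ∈ momOp.graph ↔
      TemperedDistribution.derivCLM ℂ (toDistr u) = toDistr (Complex.I • g) := by
  have h : ∀ z ∈ momGraph, z.1 = 0 → z.2 = 0 := by
    intro z hz h0
    have hz' : TemperedDistribution.derivCLM ℂ (toDistr z.1) = toDistr (Complex.I • z.2) := hz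
    rw [h0, map_zero, map_zero] at hz'
    have hk := Lp.ker_toTemperedDistributionCLM_eq_bot (E := ℝ) (F := ℂ)
      (μ := (volume : Measure ℝ)) (p := 2)
    have hm : Complex.I • z.2 ∈ (toDistr : L2R →L[ℂ] 𝓢'(ℝ, ℂ)).ker := hz'.symm
    rw [hk] at hm
    have h1 : Complex.I • z.2 = 0 := hm
    exact (smul_eq_zero.mp h1).resolve_left Complex.I_ne_zero
  rw [momOp, Submodule.toLinearPMap_graph_eq _ h]
  rfl

/-- The identity operator, defined everywhere. -/
def idOp : L2R →ₗ.[ℂ] L2R := LinearMap.id.toPMap ⊤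

/-- The composition `A B` of two partially defined operators on its natural domain
`{u ∈ Dom B | B u ∈ Dom A}`. -/
def opComp (A B : L2R →ₗ.[ℂ] L2R) : L2R →ₗ.[ℂ] L2R where
  domain := (A.domain.comap B.toFun).map B.domain.subtype
  toFun :=
    { toFun := fun u => A ⟨B ⟨u, by
          obtain ⟨v, _, hv⟩ := u.2
          rw [← hv]; exact v.2⟩, by
          obtain ⟨u, ⟨v, hv, rfl⟩⟩ := u
          exact hv⟩
      map_add' := by
        rintro ⟨_, ⟨v, hv, rfl⟩⟩ ⟨_, ⟨w, hw, rfl⟩⟩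
        rw [← A.map_add]
        congr 1
        exact Subtype.ext (B.map_add v w)
      map_smul' := by
        rintro c ⟨_, ⟨v, hv, rfl⟩⟩
        rw [RingHom.id_apply, ← A.map_smul]
        congr 1
        exact Subtype.ext (B.map_smul c v) }

/-- The number operator `N = (p² + q² - 1) / 2` with domain `{u ∈ L² | p² u, q² u ∈ L²}`. -/
def numberOp : L2R →ₗ.[ℂ] L2R :=
  (1 / 2 : ℂ) • (opComp momOp momOp + opComp posOp posOp - idOp)

/-! ### The operators of the quantum Fokker--Planck model -/

/-- `Δ = D_pp D_qq - D_pq² - γ² / 4`. -/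
def lindbladDelta (Dpp Dpq Dqq γ : ℝ) : ℝ := Dpp * Dqq - Dpq ^ 2 - γ ^ 2 / 4

/-- The adjusted Hamiltonian `H = (p² + ω² q² + γ (p q + q p)) / 2 + V(q)`. -/
def hamiltonian (ω γ : ℝ) (V : ℝ → ℝ) : L2R →ₗ.[ℂ] L2R :=
  (1 / 2 : ℂ) • (opComp momOp momOp + ((ω : ℂ) ^ 2) • opComp posOp posOp
    + (γ : ℂ) • (opComp momOp posOp + opComp posOp momOp)) + mulOp V

/-- The Lindblad operator `L₁ = (-2 D_pq + i γ) / √(2 D_pp) p + √(2 D_pp) q`. -/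
def lindblad₁ (Dpp Dpq γ : ℝ) : L2R →ₗ.[ℂ] L2R :=
  ((-2 * (Dpq : ℂ) + Complex.I * (γ : ℂ)) / ((√(2 * Dpp) : ℝ) : ℂ)) • momOp
    + ((√(2 * Dpp) : ℝ) : ℂ) • posOp

/-- The Lindblad operator `L₂ = 2 √Δ / √(2 D_pp) p`. -/
def lindblad₂ (Dpp Dpq Dqq γ : ℝ) : L2R →ₗ.[ℂ] L2R :=
  ((2 * √(lindbladDelta Dpp Dpq Dqq γ) / √(2 * Dpp) : ℝ) : ℂ) • momOp

/-- The operator `-(L₁* L₁ + L₂* L₂) / 2 - i H` on `Dom N`; meaningful for `D_pp > 0`. -/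
def lindbladG (ω Dpp Dpq Dqq γ : ℝ) (V : ℝ → ℝ) : L2R →ₗ.[ℂ] L2R :=
  ((-(1 / 2) : ℂ) •
      (opComp (lindblad₁ Dpp Dpq γ).adjoint (lindblad₁ Dpp Dpq γ)
        + opComp (lindblad₂ Dpp Dpq Dqq γ).adjoint (lindblad₂ Dpp Dpq Dqq γ))
    - Complex.I • hamiltonian ω γ V).domRestrict numberOp.domain

/-- The operator
`G = -(D_qq + i/2) p² - (D_pp + i ω²/2) q² + (D_pq - i γ/2) (p q + q p) + γ/2 - i V(q)`
on `Dom N`. -/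
def opG (ω Dpp Dpq Dqq γ : ℝ) (V : ℝ → ℝ) : L2R →ₗ.[ℂ] L2R :=
  ((-((Dqq : ℂ) + Complex.I / 2)) • opComp momOp momOp
    - ((Dpp : ℂ) + Complex.I * (ω : ℂ) ^ 2 / 2) • opComp posOp posOp
    + ((Dpq : ℂ) - Complex.I * (γ : ℂ) / 2) • (opComp momOp posOp + opComp posOp momOp)
    + ((γ : ℂ) / 2) • idOp
    - Complex.I • mulOp V).domRestrict numberOp.domain

/-! ### Contraction semigroups and generators -/

/-- `P` is a strongly continuous semigroup of linear contractions on `L²(ℝ)`. -/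
structure IsContractionSemigroup (P : ℝ≥0 → L2R →L[ℂ] L2R) : Prop where
  map_zero : P 0 = ContinuousLinearMap.id ℂ L2R
  map_add : ∀ s t, P (s + t) = (P s).comp (P t)
  norm_le_one : ∀ t, ‖P t‖ ≤ 1
  strongly_continuous : ∀ u, Continuous fun t => P t u

/-- `A` is the infinitesimal generator of `P`: `u ∈ Dom A` and `A u = f` if and only if
`(P_t u - u) / t → f` in norm as `t ↓ 0`. -/
def IsGenerator (P : ℝ≥0 → L2R →L[ℂ] L2R) (A : L2R →ₗ.[ℂ] L2R) : Prop :=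
  ∀ u f : L2R, (u, f) ∈ A.graph ↔
    Tendsto (fun t : ℝ≥0 => ((t : ℝ) : ℂ)⁻¹ • (P t u - u)) (𝓝[>] 0) (𝓝 f)

end QFP

end

/-! Write `R` for (P² + Q²)⁻¹, a bounded operator whose range is Dom N. Second order monomials in P,
Q are bounded relative to P² + Q², and so is V(q): since V' grows sublinearly, V = o(x²). Hence G R
is bounded and the graph of G is {(R f, G R f)}. Every claim about the unbounded G becomes a claim
about the two bounded operators `invEnergy` and `opGInv`.

Dissipativity: in Re⟨u, G u⟩ the potential drops out, being real, and the constant γ/2 turns,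
through the commutator of p and q, into an imaginary off-diagonal entry of a Hermitian form in (p u,
q u). The Lindblad condition says exactly that the determinant of this form is nonnegative
(`quadraticInv_accretive`, `re_inner_opGInv_nonpos`).

Range condition: the real part of the symbol of -G may be degenerate, but after multiplication by ζ
= 1 - iμ, with μ = 0 or 1, it is positive definite (`exists_elliptic_parameters`). Pairing ζ (l R -
G R) f with f, that is with (P² + Q²) u for u = R f, gives coercivity: commutators are of lower
order and are absorbed by a large l, and V has relative bound zero. Lax–Milgram then inverts l R - G
R (`exists_isUnit_smul_invEnergy_sub`).

The semigroup comes from Hille–Yosida, proved by Yosida approximation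
(`exists_contraction_semigroup`); closedness comes from the bounded resolvent. That Dom N is the
range of `R` rests on two facts: p and q are the adjoints of their restrictions to Schwartz
functions, and P² + Q² has dense range there, being triangular on x ^ k exp (-x² / 2)
(`denseRange_schwartzEnergy`, `eq_invEnergy_of_graph`). -/

namespace QFP

/-! ### Exponentials of bounded dissipative operators -/

section Generation

variable {H : Type*} [NormedAddCommGroup H] [InnerProductSpace ℂ H]

/-- The orbit `t ↦ exp (t B) u` of the group generated by a bounded operator. -/
theorem hasDerivAt_exp_smul_apply [CompleteSpace H] (B : H →L[ℂ] H) (u : H) (t : ℝ) :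
    HasDerivAt (fun s : ℝ => NormedSpace.exp (s • B) u)
      (NormedSpace.exp (t • B) (B u)) t := by
  have h := (hasDerivAt_exp_smul_const (𝕂 := ℝ) B t)
  exact ((ContinuousLinearMap.apply ℂ H u).restrictScalars ℝ).hasFDerivAt.comp_hasDerivAt t h

theorem exp_smul_apply_comm [CompleteSpace H] {A B : H →L[ℂ] H} (h : Commute A B) (t : ℝ) (u : H) :
    NormedSpace.exp (t • A) (B u) = B (NormedSpace.exp (t • A) u) := by
  have h1 : Commute (NormedSpace.exp (t • A)) B :=
    Commute.exp_left (h.smul_left t)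
  exact congrArg (fun T : H →L[ℂ] H => T u) h1.eq

theorem norm_exp_smul_apply_le [CompleteSpace H] {B : H →L[ℂ] H}
    (hB : ∀ v, (inner ℂ v (B v)).re ≤ 0) {t : ℝ} (ht : 0 ≤ t) (u : H) :
    ‖NormedSpace.exp (t • B) u‖ ≤ ‖u‖ := by
  let _ : InnerProductSpace ℝ H := InnerProductSpace.rclikeToReal ℂ H
  have hd : ∀ s : ℝ, HasDerivAt (fun s : ℝ => ‖NormedSpace.exp (s • B) u‖ ^ 2)
      (2 * (inner ℂ (NormedSpace.exp (s • B) u) (B (NormedSpace.exp (s • B) u))).re) s := by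
    intro s
    have h := (hasDerivAt_exp_smul_apply B u s).norm_sq
    rw [exp_smul_apply_comm (Commute.refl B)] at h
    exact h
  have hanti : Antitone (fun s : ℝ => ‖NormedSpace.exp (s • B) u‖ ^ 2) := by
    apply antitone_of_deriv_nonpos (fun s => (hd s).differentiableAt)
    intro s
    rw [(hd s).deriv]
    have := hB (NormedSpace.exp (s • B) u)
    linarith
  have h := hanti ht
  simp only [zero_smul, NormedSpace.exp_zero, one_apply_eq_self] at h
  exact le_of_sq_le_sq h (norm_nonneg _)

/-- Duhamel: s ↦ exp (s A) exp ((t - s) B) u joins the two orbits, and by commutation its derivative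
is a product of two contractions applied to A u - B u. -/
theorem norm_exp_smul_sub_exp_smul_apply_le [CompleteSpace H] {A B : H →L[ℂ] H} (hc : Commute A B)
    (hA : ∀ v, (inner ℂ v (A v)).re ≤ 0) (hB : ∀ v, (inner ℂ v (B v)).re ≤ 0)
    {t : ℝ} (ht : 0 ≤ t) (u : H) :
    ‖NormedSpace.exp (t • A) u - NormedSpace.exp (t • B) u‖ ≤ t * ‖A u - B u‖ := by
  have hd : ∀ s : ℝ, HasDerivAt
      (fun s : ℝ => NormedSpace.exp (s • A) (NormedSpace.exp ((t - s) • B) u))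
      (NormedSpace.exp (s • A) (NormedSpace.exp ((t - s) • B) (A u - B u))) s := by
    intro s
    have h1 := hasDerivAt_exp_smul_const (𝕂 := ℝ) A s
    have h2 := (hasDerivAt_exp_smul_const (𝕂 := ℝ) B (t - s)).scomp s
      ((hasDerivAt_id s).const_sub t)
    have h3 := h1.mul h2
    have h4 := ((ContinuousLinearMap.apply ℂ H u).restrictScalars ℝ).hasFDerivAt.comp_hasDerivAt s h3
    refine h4.congr_deriv ?_
    have e1 := exp_smul_apply_comm hc.symm (t - s) u
    rw [sub_eq_add_neg] at e1
    simp [e1, sub_eq_add_neg]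
  have h := norm_image_sub_le_of_norm_deriv_le_segment' (a := 0) (b := t) (C := ‖A u - B u‖)
    (fun s _ => (hd s).hasDerivWithinAt) (fun s hs =>
      (norm_exp_smul_apply_le hA hs.1 _).trans
        (norm_exp_smul_apply_le hB (sub_nonneg.2 hs.2.le) _)) t ⟨ht, le_rfl⟩
  simpa [mul_comm] using h

theorem norm_exp_smul_apply_sub_le [CompleteSpace H] {A : H →L[ℂ] H}
    (hA : ∀ v, (inner ℂ v (A v)).re ≤ 0) {t : ℝ} (ht : 0 ≤ t) (u : H) :
    ‖NormedSpace.exp (t • A) u - u‖ ≤ t * ‖A u‖ := by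
  simpa using norm_exp_smul_sub_exp_smul_apply_le (Commute.zero_right A) hA (by simp) ht u

/-- The vector v is meant to be a domain vector close to A u. Passing through A v avoids A² u, which
need not stay bounded along Yosida approximations. -/
theorem norm_exp_smul_apply_sub_sub_le [CompleteSpace H] {A : H →L[ℂ] H}
    (hA : ∀ v, (inner ℂ v (A v)).re ≤ 0) {t : ℝ} (ht : 0 ≤ t) (u v : H) :
    ‖NormedSpace.exp (t • A) u - u - t • A u‖ ≤ t * (2 * ‖A u - v‖ + t * ‖A v‖) := by
  have hd : ∀ s : ℝ, HasDerivAt (fun s : ℝ => NormedSpace.exp (s • A) u - s • A u)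
      (NormedSpace.exp (s • A) (A u) - A u) s := by
    intro s
    have := (hasDerivAt_exp_smul_apply A u s).sub ((hasDerivAt_id s).smul_const (A u))
    rw [one_smul] at this
    exact this
  have hb : ∀ s ∈ Set.Ico 0 t, ‖NormedSpace.exp (s • A) (A u) - A u‖
      ≤ 2 * ‖A u - v‖ + t * ‖A v‖ := by
    intro s hs
    have e : NormedSpace.exp (s • A) (A u) - A u
        = NormedSpace.exp (s • A) (A u - v) + (NormedSpace.exp (s • A) v - v) - (A u - v) := by
      rw [map_sub]; abel
    rw [e]
    have h1 := norm_exp_smul_apply_le hA hs.1 (A u - v)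
    have h2 := norm_exp_smul_apply_sub_le hA hs.1 v
    have h3 : s * ‖A v‖ ≤ t * ‖A v‖ := by gcongr; exact hs.2.le
    calc _ ≤ _ := norm_sub_le _ _
      _ ≤ _ := add_le_add_left (norm_add_le _ _) _
      _ ≤ _ := by linarith
  have h := norm_image_sub_le_of_norm_deriv_le_segment' (a := 0) (b := t)
    (fun s _ => (hd s).hasDerivWithinAt) hb t ⟨ht, le_rfl⟩
  have e : NormedSpace.exp (t • A) u - u - t • A u = NormedSpace.exp (t • A) u - t • A u - u := by
    abel
  rw [e]
  simpa [mul_comm] using h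

end Generation

end QFP

namespace QFP

/-! ### The Hille–Yosida theorem for a graph {(R w, G w)} -/

section Yosida

variable {H : Type*} [NormedAddCommGroup H] [InnerProductSpace ℂ H]

/-- The resolvent at `n` of the operator with graph `{(R w, G w)}`. -/
noncomputable def resolventOf (R G : H →L[ℂ] H) (n : ℝ) : H →L[ℂ] H :=
  R * Ring.inverse (n • R - G)

/-- The Yosida approximation at `n` of the operator with graph `{(R w, G w)}`. -/
noncomputable def yosidaApprox (R G : H →L[ℂ] H) (n : ℝ) : H →L[ℂ] H :=
  n • (n • resolventOf R G n - 1)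

variable {R G : H →L[ℂ] H}

theorem mul_norm_le_norm_smul_sub (hdiss : ∀ w, (inner ℂ (R w) (G w)).re ≤ 0) (n : ℝ) (w : H) :
    n * ‖R w‖ ≤ ‖n • R w - G w‖ := by
  rcases (norm_nonneg (R w)).eq_or_lt with h0 | h0
  · rw [← h0]; simp
  have h1 : n * ‖R w‖ ^ 2 ≤ (inner ℂ (R w) (n • R w - G w)).re := by
    have e : (inner ℂ (R w) (n • R w)).re = n * ‖R w‖ ^ 2 := by
      rw [← inner_self_eq_norm_sq (𝕜 := ℂ), inner_smul_right_eq_smul]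
      simp
    rw [inner_sub_right, Complex.sub_re, e]
    linarith [hdiss w]
  have h2 := (Complex.re_le_norm _).trans (norm_inner_le_norm (𝕜 := ℂ) (R w) (n • R w - G w))
  nlinarith

theorem resolventOf_apply_smul_sub {n : ℝ} (hu : IsUnit (n • R - G)) (w : H) :
    resolventOf R G n (n • R w - G w) = R w := by
  have h := congrArg (fun T : H →L[ℂ] H => T w) (Ring.inverse_mul_cancel _ hu)
  exact congrArg R h

theorem exists_resolventOf {n : ℝ} (hu : IsUnit (n • R - G)) (v : H) :
    ∃ w, n • R w - G w = v ∧ resolventOf R G n v = R w := by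
  have h := congrArg (fun T : H →L[ℂ] H => T v) (Ring.mul_inverse_cancel _ hu)
  exact ⟨Ring.inverse (n • R - G) v, h, rfl⟩

theorem norm_resolventOf_apply_le (hdiss : ∀ w, (inner ℂ (R w) (G w)).re ≤ 0) {n : ℝ}
    (hu : IsUnit (n • R - G)) (v : H) : n * ‖resolventOf R G n v‖ ≤ ‖v‖ := by
  obtain ⟨w, rfl, hw⟩ := exists_resolventOf hu v
  rw [hw]
  exact mul_norm_le_norm_smul_sub hdiss n w

theorem resolventOf_apply_eq {n m : ℝ} (hn : IsUnit (n • R - G)) (hm : IsUnit (m • R - G)) (v : H) :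
    resolventOf R G m v
      = resolventOf R G n v + (n - m) • resolventOf R G n (resolventOf R G m v) := by
  obtain ⟨w, hv, hw⟩ := exists_resolventOf hm v
  rw [hw]
  have h := resolventOf_apply_smul_sub hn w
  have e : n • R w - G w = v + (n - m) • R w := by rw [← hv, sub_smul]; abel
  rw [e, map_add, ContinuousLinearMap.map_smul_of_tower] at h
  exact h.symm

/-- The resolvent identity with n and m exchanged gives two expressions for the same difference;
divide by n - m. -/
theorem commute_resolventOf {n m : ℝ} (hn : IsUnit (n • R - G)) (hm : IsUnit (m • R - G)) :
    Commute (resolventOf R G n) (resolventOf R G m) := by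
  rcases eq_or_ne n m with rfl | hne
  · exact Commute.refl _
  ext v
  have h1 := resolventOf_apply_eq hn hm v
  have h2 := resolventOf_apply_eq hm hn v
  have h3 : (n - m) • (resolventOf R G n (resolventOf R G m v)
      - resolventOf R G m (resolventOf R G n v)) = 0 := by
    have e : (m - n) • resolventOf R G m (resolventOf R G n v)
        = -((n - m) • resolventOf R G m (resolventOf R G n v)) := by
      rw [← neg_smul, neg_sub]
    rw [e] at h2
    rw [smul_sub, sub_eq_zero]
    have h4 : (n - m) • resolventOf R G n (resolventOf R G m v)
        = resolventOf R G m v - resolventOf R G n v := by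
      rw [eq_sub_iff_add_eq, add_comm]; exact h1.symm
    have h5 : (n - m) • resolventOf R G m (resolventOf R G n v)
        = resolventOf R G m v - resolventOf R G n v := by
      rw [eq_sub_iff_add_eq, ← eq_sub_iff_add_eq', sub_eq_add_neg]; exact h2
    rw [h4, h5]
  exact sub_eq_zero.1 ((smul_eq_zero.1 h3).resolve_left (sub_ne_zero.2 hne))

theorem commute_yosidaApprox {n m : ℝ} (hn : IsUnit (n • R - G)) (hm : IsUnit (m • R - G)) :
    Commute (yosidaApprox R G n) (yosidaApprox R G m) := by
  unfold yosidaApprox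
  refine Commute.smul_left (Commute.smul_right ?_ _) _
  refine Commute.sub_left (Commute.sub_right ?_ (Commute.one_right _)) (Commute.one_left _)
  exact Commute.smul_left (Commute.smul_right (commute_resolventOf hn hm) _) _

theorem yosidaApprox_apply_range {n : ℝ} (hn : IsUnit (n • R - G)) (w : H) :
    yosidaApprox R G n (R w) = n • resolventOf R G n (G w) := by
  have h := resolventOf_apply_smul_sub hn w
  rw [map_sub, ContinuousLinearMap.map_smul_of_tower, sub_eq_iff_eq_add] at h
  simp [yosidaApprox, h]

/-- For v = n R w - G w the approximation takes the value n G w, so the real part is n² Re⟨R w, G w⟩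
- n ‖G w‖². -/
theorem re_inner_yosidaApprox_le (hdiss : ∀ w, (inner ℂ (R w) (G w)).re ≤ 0)
    {n : ℝ} (h0 : 0 ≤ n) (hn : IsUnit (n • R - G)) (v : H) :
    (inner ℂ v (yosidaApprox R G n v)).re ≤ 0 := by
  obtain ⟨w, rfl, hw⟩ := exists_resolventOf hn v
  have e : yosidaApprox R G n (n • R w - G w) = n • G w := by
    simp [yosidaApprox, hw]
  rw [e, inner_smul_right_eq_smul, Complex.smul_re, inner_sub_left, Complex.sub_re,
    inner_smul_left_eq_smul, Complex.smul_re]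
  have h1 : 0 ≤ (inner ℂ (G w) (G w)).re := inner_self_nonneg (𝕜 := ℂ)
  simp only [smul_eq_mul]
  nlinarith [hdiss w, mul_nonneg h0 h1, mul_nonneg h0 h0, mul_nonneg (mul_nonneg h0 h0) (neg_nonneg.2 (hdiss w))]

/-- On the range of `R` the error is the resolvent applied to G w, of size ‖G w‖ / n; the uniform
contraction bound and density give the rest. -/
theorem tendsto_smul_resolventOf (hR : DenseRange R)
    (hdiss : ∀ w, (inner ℂ (R w) (G w)).re ≤ 0) {c : ℝ}
    (hu : ∀ n : ℝ, c ≤ n → IsUnit (n • R - G)) (v : H) :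
    Tendsto (fun n : ℝ => n • resolventOf R G n v) atTop (𝓝 v) := by
  rw [Metric.tendsto_atTop]
  intro ε hε
  obtain ⟨w, hw⟩ := hR.exists_dist_lt v (show 0 < ε / 3 by positivity)
  refine ⟨max (max c 1) (3 * ‖G w‖ / ε + 1), fun n hn => ?_⟩
  have hc : c ≤ n := (le_max_left _ _).trans ((le_max_left _ _).trans hn)
  have h1 : 1 ≤ n := (le_max_right _ _).trans ((le_max_left _ _).trans hn)
  have h2 : 3 * ‖G w‖ / ε + 1 ≤ n := (le_max_right _ _).trans hn
  have h0 : 0 < n := by linarith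
  have a1 : ‖n • resolventOf R G n (v - R w)‖ ≤ ‖v - R w‖ := by
    rw [norm_smul, Real.norm_of_nonneg h0.le]
    exact norm_resolventOf_apply_le hdiss (hu n hc) _
  have a2 : n • resolventOf R G n (R w) - R w = resolventOf R G n (G w) := by
    have h := resolventOf_apply_smul_sub (hu n hc) w
    rw [map_sub, ContinuousLinearMap.map_smul_of_tower] at h
    rw [sub_eq_iff_eq_add, ← sub_eq_iff_eq_add']
    exact h
  have a3 : ‖resolventOf R G n (G w)‖ < ε / 3 := by
    have h := norm_resolventOf_apply_le hdiss (hu n hc) (G w)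
    have h3 : 3 * ‖G w‖ < ε * n := by
      have : 3 * ‖G w‖ / ε < n := by linarith
      rw [div_lt_iff₀ hε] at this
      linarith
    by_contra! hcon
    nlinarith
  have e : n • resolventOf R G n v - v = n • resolventOf R G n (v - R w)
      + (n • resolventOf R G n (R w) - R w) - (v - R w) := by
    rw [map_sub, smul_sub]; abel
  rw [dist_eq_norm, e, a2]
  rw [dist_eq_norm] at hw
  calc _ ≤ _ := norm_sub_le _ _
    _ ≤ _ := add_le_add_left (norm_add_le _ _) _
    _ < ε := by linarith

theorem tendsto_yosidaApprox (hR : DenseRange R)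
    (hdiss : ∀ w, (inner ℂ (R w) (G w)).re ≤ 0) {c : ℝ}
    (hu : ∀ n : ℝ, c ≤ n → IsUnit (n • R - G)) (w : H) :
    Tendsto (fun n : ℝ => yosidaApprox R G n (R w)) atTop (𝓝 (G w)) := by
  refine (tendsto_smul_resolventOf hR hdiss hu (G w)).congr' ?_
  filter_upwards [eventually_ge_atTop c] with n hn
  rw [yosidaApprox_apply_range (hu n hn)]

theorem exists_tendsto_exp_yosidaApprox [CompleteSpace H] (hR : DenseRange R)
    (hdiss : ∀ w, (inner ℂ (R w) (G w)).re ≤ 0) {c : ℝ}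
    (hu : ∀ n : ℝ, c ≤ n → IsUnit (n • R - G)) {t : ℝ} (ht : 0 ≤ t) (v : H) :
    ∃ y, Tendsto (fun n : ℝ => NormedSpace.exp (t • yosidaApprox R G n) v) atTop (𝓝 y) := by
  apply cauchy_map_iff_exists_tendsto.1
  rw [Metric.cauchy_iff]
  refine ⟨inferInstance, fun ε hε => ?_⟩
  obtain ⟨w, hw⟩ := hR.exists_dist_lt v (show 0 < ε / 4 by positivity)
  have hlim := tendsto_yosidaApprox hR hdiss hu w
  -- Two such errors multiplied by t stay below ε / 4; using t + 1 keeps the quotient meaningful at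
  -- t = 0.
  have hδ : 0 < ε / (8 * (t + 1)) := by positivity
  have hev := (hlim.eventually (Metric.ball_mem_nhds _ hδ)).and
    ((eventually_ge_atTop c).and (eventually_ge_atTop 0))
  refine ⟨_, image_mem_map hev, ?_⟩
  rintro _ ⟨n, ⟨h1, h2, h3⟩, rfl⟩ _ ⟨m, ⟨k1, k2, k3⟩, rfl⟩
  have dn := re_inner_yosidaApprox_le hdiss h3 (hu n h2)
  have dm := re_inner_yosidaApprox_le hdiss k3 (hu m k2)
  have a := norm_exp_smul_sub_exp_smul_apply_le (commute_yosidaApprox (hu n h2) (hu m k2))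
    dn dm ht (R w)
  have b1 := norm_exp_smul_apply_le dn ht (v - R w)
  have b2 := norm_exp_smul_apply_le dm ht (v - R w)
  have h4 : ‖yosidaApprox R G n (R w) - yosidaApprox R G m (R w)‖ ≤ ε / (4 * (t + 1)) := by
    rw [← dist_eq_norm]
    have := dist_triangle_right (yosidaApprox R G n (R w)) (yosidaApprox R G m (R w)) (G w)
    have h5 : dist (yosidaApprox R G n (R w)) (G w) < ε / (8 * (t + 1)) := h1
    have h6 : dist (yosidaApprox R G m (R w)) (G w) < ε / (8 * (t + 1)) := k1
    have h7 : ε / (4 * (t + 1)) = ε / (8 * (t + 1)) + ε / (8 * (t + 1)) := by field_simp; ring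
    linarith
  have h8 : t * ‖yosidaApprox R G n (R w) - yosidaApprox R G m (R w)‖ ≤ ε / 4 := by
    calc _ ≤ t * (ε / (4 * (t + 1))) := by gcongr
      _ = (ε / 4) * (t / (t + 1)) := by field_simp
      _ ≤ (ε / 4) * 1 := by gcongr; rw [div_le_one (by positivity)]; linarith
      _ = _ := mul_one _
  rw [dist_eq_norm] at hw ⊢
  have e : NormedSpace.exp (t • yosidaApprox R G n) v - NormedSpace.exp (t • yosidaApprox R G m) v
      = NormedSpace.exp (t • yosidaApprox R G n) (v - R w)
        + (NormedSpace.exp (t • yosidaApprox R G n) (R w)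
          - NormedSpace.exp (t • yosidaApprox R G m) (R w))
        - NormedSpace.exp (t • yosidaApprox R G m) (v - R w) := by
    rw [map_sub, map_sub]; abel
  rw [e]
  calc _ ≤ _ := norm_sub_le _ _
    _ ≤ _ := add_le_add_left (norm_add_le _ _) _
    _ < ε := by linarith

/-- The **Hille–Yosida theorem** for dissipative operators given by a graph `{(R w, G w)}`. -/
theorem exists_contraction_semigroup [CompleteSpace H] (hR : DenseRange R)
    (hdiss : ∀ w, (inner ℂ (R w) (G w)).re ≤ 0) {c : ℝ}
    (hu : ∀ n : ℝ, c ≤ n → IsUnit (n • R - G)) :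
    ∃ P : ℝ≥0 → H →L[ℂ] H, P 0 = ContinuousLinearMap.id ℂ H ∧
      (∀ s t, P (s + t) = (P s).comp (P t)) ∧ (∀ t, ‖P t‖ ≤ 1) ∧
      (∀ u, Continuous fun t => P t u) ∧
      ∀ u f : H, (∃ w, R w = u ∧ G w = f) ↔
        Tendsto (fun t : ℝ≥0 => ((t : ℝ) : ℂ)⁻¹ • (P t u - u)) (𝓝[>] 0) (𝓝 f) := by
  choose P₀ hP₀ using fun (t : ℝ≥0) (v : H) =>
    exists_tendsto_exp_yosidaApprox hR hdiss hu t.2 v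
  let P : ℝ≥0 → H →L[ℂ] H := fun t =>
    continuousLinearMapOfTendsto (fun n : ℝ => NormedSpace.exp ((t : ℝ) • yosidaApprox R G n))
      (tendsto_pi_nhds.2 (hP₀ t))
  have hP : ∀ (t : ℝ≥0) (v : H), Tendsto (fun n : ℝ => NormedSpace.exp ((t : ℝ) • yosidaApprox R G n) v) atTop
      (𝓝 (P t v)) := hP₀
  have hev : ∀ᶠ n : ℝ in atTop, IsUnit (n • R - G) ∧
      ∀ v, (inner ℂ v (yosidaApprox R G n v)).re ≤ 0 := by
    filter_upwards [eventually_ge_atTop c, eventually_ge_atTop 0] with n h1 h2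
    exact ⟨hu n h1, re_inner_yosidaApprox_le hdiss h2 (hu n h1)⟩
  have hnorm : ∀ t v, ‖P t v‖ ≤ ‖v‖ := fun t v =>
    le_of_tendsto (hP t v).norm (hev.mono fun n hn => norm_exp_smul_apply_le hn.2 t.2 v)
  have hzero : P 0 = ContinuousLinearMap.id ℂ H := by
    ext v
    refine tendsto_nhds_unique (hP 0 v) ?_
    simp
  have hadd : ∀ s t, P (s + t) = (P s).comp (P t) := by
    intro s t
    ext v
    refine tendsto_nhds_unique (hP (s + t) v) ?_
    have h1 := hP s (P t v)
    have h2 : Tendsto (fun n : ℝ => NormedSpace.exp ((s : ℝ) • yosidaApprox R G n)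
        (NormedSpace.exp ((t : ℝ) • yosidaApprox R G n) v - P t v)) atTop (𝓝 0) := by
      have h3 : Tendsto (fun n : ℝ => ‖NormedSpace.exp ((t : ℝ) • yosidaApprox R G n) v - P t v‖)
          atTop (𝓝 0) := by
        rw [← tendsto_iff_norm_sub_tendsto_zero]
        exact hP t v
      exact squeeze_zero_norm' (hev.mono fun n hn => norm_exp_smul_apply_le hn.2 s.2 _) h3
    have h4 := h2.add h1
    rw [zero_add] at h4
    refine h4.congr fun n => ?_
    have e : NormedSpace.exp (((s + t : ℝ≥0) : ℝ) • yosidaApprox R G n)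
        = NormedSpace.exp ((s : ℝ) • yosidaApprox R G n)
          * NormedSpace.exp ((t : ℝ) • yosidaApprox R G n) := by
      let _ : NormedAlgebra ℚ (H →L[ℂ] H) := NormedAlgebra.restrictScalars ℚ ℝ _
      rw [NNReal.coe_add, add_smul]
      exact NormedSpace.exp_add_of_commute
        (((Commute.refl _).smul_left _).smul_right _)
    rw [e, map_sub, sub_add_cancel]
    rfl
  have hlip : ∀ t w, ‖P t (R w) - R w‖ ≤ t * ‖G w‖ := fun t w =>
    le_of_tendsto_of_tendsto ((hP t (R w)).sub_const _).norm
      ((tendsto_yosidaApprox hR hdiss hu w).norm.const_mul _)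
      (hev.mono fun n hn => norm_exp_smul_apply_sub_le hn.2 t.2 _)
  -- The second order bound is uniform in n, so it survives the limit.
  have hgen : ∀ t w v, ‖P t (R w) - R w - (t : ℝ) • G w‖
      ≤ t * (2 * ‖G w - R v‖ + t * ‖G v‖) := fun t w v => by
    have h1 := tendsto_yosidaApprox hR hdiss hu w
    have h2 := tendsto_yosidaApprox hR hdiss hu v
    exact le_of_tendsto_of_tendsto (((hP t (R w)).sub_const _).sub (h1.const_smul _)).norm
      ((((h1.sub_const _).norm.const_mul _).add (h2.norm.const_mul _)).const_mul _)
      (hev.mono fun n hn => norm_exp_smul_apply_sub_sub_le hn.2 t.2 _ _)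
  have hlip2 : ∀ w (s t : ℝ≥0), dist (P s (R w)) (P t (R w)) ≤ ‖G w‖ * dist s t := by
    have key : ∀ w (s t : ℝ≥0), s ≤ t →
        dist (P s (R w)) (P t (R w)) ≤ ‖G w‖ * dist s t := by
      intro w s t hst
      obtain ⟨d, rfl⟩ := exists_add_of_le hst
      rw [dist_comm, dist_eq_norm, hadd, ContinuousLinearMap.comp_apply, ← map_sub]
      refine (hnorm _ _).trans ((hlip d w).trans (le_of_eq ?_))
      rw [NNReal.dist_eq, NNReal.coe_add, sub_add_cancel_left, abs_neg, abs_of_nonneg d.coe_nonneg, mul_comm]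
    intro w s t
    rcases le_total s t with h | h
    · exact key w s t h
    · rw [dist_comm, dist_comm s]; exact key w t s h
  have hcont : ∀ u, Continuous fun t => P t u := by
    intro u
    apply continuous_of_uniform_approx_of_continuous
    intro U hU
    obtain ⟨ε, hε, hεU⟩ := Metric.mem_uniformity_dist.1 hU
    obtain ⟨w, hw⟩ := hR.exists_dist_lt u hε
    refine ⟨fun t => P t (R w), ?_, fun t => hεU ?_⟩
    · exact (LipschitzWith.of_dist_le_mul (K := ‖G w‖₊) (hlip2 w)).continuous
    · rw [dist_eq_norm, ← map_sub]
      rw [dist_eq_norm] at hw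
      exact (hnorm _ _).trans_lt hw
  have hnt : (𝓝[>] (0 : ℝ≥0)).NeBot := inferInstance
  have hfwd : ∀ w, Tendsto (fun t : ℝ≥0 => ((t : ℝ) : ℂ)⁻¹ • (P t (R w) - R w)) (𝓝[>] 0)
      (𝓝 (G w)) := by
    intro w
    rw [Metric.tendsto_nhdsWithin_nhds]
    intro ε hε
    -- G w need not lie in the domain; it is replaced by a domain vector R v at distance below ε /
    -- 4.
    obtain ⟨v, hv⟩ := hR.exists_dist_lt (G w) (show 0 < ε / 4 by positivity)
    refine ⟨ε / (2 * (‖G v‖ + 1)), by positivity, fun {t} ht hd => ?_⟩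
    have ht0 : 0 < (t : ℝ) := ht
    rw [NNReal.dist_eq, NNReal.coe_zero, sub_zero, abs_of_pos ht0,
      lt_div_iff₀ (by positivity)] at hd
    have e : ((t : ℝ) : ℂ)⁻¹ • (P t (R w) - R w) - G w
        = ((t : ℝ) : ℂ)⁻¹ • (P t (R w) - R w - (t : ℝ) • G w) := by
      rw [smul_sub (((t : ℝ) : ℂ)⁻¹) (P t (R w) - R w) ((t : ℝ) • G w),
        ← Complex.coe_smul, smul_smul, inv_mul_cancel₀ (by exact_mod_cast ht0.ne'), one_smul]
    rw [dist_eq_norm, e, norm_smul, norm_inv, Complex.norm_real, Real.norm_of_nonneg ht0.le]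
    rw [dist_eq_norm] at hv
    have h1 := hgen t w v
    calc _ ≤ (t : ℝ)⁻¹ * (t * (2 * ‖G w - R v‖ + t * ‖G v‖)) := by gcongr
      _ = 2 * ‖G w - R v‖ + t * ‖G v‖ := by rw [inv_mul_cancel_left₀ ht0.ne']
      _ < ε := by nlinarith [norm_nonneg (G v)]
  refine ⟨P, hzero, hadd, fun t => ContinuousLinearMap.opNorm_le_bound _ zero_le_one
    fun v => by simpa using hnorm t v, hcont, fun u f => ⟨?_, fun hf => ?_⟩⟩
  · rintro ⟨w, rfl, rfl⟩
    exact hfwd w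
  -- A dissipative operator with full range of n - G has no proper dissipative extension. Solving n
  -- R w - G w = n u - f, the difference z = u - R w has derivative n z at time 0; contractivity
  -- forces Re⟨z, n z⟩ ≤ 0, so z = 0.
  · set n := max c 1
    have hn0 : 0 < n := lt_of_lt_of_le one_pos (le_max_right _ _)
    obtain ⟨w, hw, -⟩ := exists_resolventOf (hu n (le_max_left _ _)) (n • u - f)
    have hz := hf.sub (hfwd w)
    have hfG : f - G w = n • (u - R w) := by
      have e : f = n • u - (n • R w - G w) := by rw [hw]; abel
      rw [e, smul_sub]; abel
    rw [hfG] at hz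
    have hz2 : Tendsto (fun t : ℝ≥0 => (inner ℂ (u - R w)
        (((t : ℝ) : ℂ)⁻¹ • (P t (u - R w) - (u - R w)))).re) (𝓝[>] 0)
        (𝓝 (inner ℂ (u - R w) (n • (u - R w))).re) := by
      refine (Complex.continuous_re.tendsto _).comp (Tendsto.inner tendsto_const_nhds ?_)
      refine hz.congr fun t => ?_
      rw [← smul_sub, map_sub]
      congr 1; abel
    have hle : (inner ℂ (u - R w) (n • (u - R w))).re ≤ 0 := by
      refine le_of_tendsto hz2 (eventually_nhdsWithin_of_forall fun t ht => ?_)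
      rw [inner_smul_right, ← Complex.ofReal_inv, Complex.re_ofReal_mul, inner_sub_right,
        Complex.sub_re]
      refine mul_nonpos_of_nonneg_of_nonpos (inv_nonneg.2 t.2) (sub_nonpos.2 ?_)
      calc _ ≤ _ := Complex.re_le_norm _
        _ ≤ _ := norm_inner_le_norm _ _
        _ ≤ ‖u - R w‖ * ‖u - R w‖ := by gcongr; exact hnorm _ _
        _ = _ := (inner_self_eq_norm_mul_norm (𝕜 := ℂ) (u - R w)).symm
    have hz0 : u - R w = 0 := by
      rw [inner_smul_right_eq_smul, Complex.smul_re, smul_eq_mul] at hle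
      have h1 : (inner ℂ (u - R w) (u - R w)).re ≤ 0 := by
        by_contra! h
        nlinarith
      exact (re_inner_self_nonpos (𝕜 := ℂ)).1 h1
    rw [hz0, smul_zero, sub_eq_zero] at hfG
    exact ⟨w, (sub_eq_zero.1 hz0).symm, hfG.symm⟩

end Yosida

end QFP

namespace QFP

/-! ### Estimates from the canonical commutation relation -/

section CanonicalPair

variable {H S : Type*} [NormedAddCommGroup H] [InnerProductSpace ℂ H] [AddCommGroup S] [Module ℂ S]

/-- Symmetric operators `P`, `Q` on a common invariant domain `S`, embedded in a Hilbert space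
by `J`, with `P Q - Q P = -i`. -/
structure IsCanonicalPair (J : S →ₗ[ℂ] H) (P Q : S →ₗ[ℂ] S) : Prop where
  symm_left : ∀ φ ψ, inner ℂ (J (P φ)) (J ψ) = inner ℂ (J φ) (J (P ψ))
  symm_right : ∀ φ ψ, inner ℂ (J (Q φ)) (J ψ) = inner ℂ (J φ) (J (Q ψ))
  comm : ∀ φ, P (Q φ) = Q (P φ) - Complex.I • φ

theorem inner_re_comm (x y : H) : (inner ℂ x y).re = (inner ℂ y x).re :=
  inner_re_symm (𝕜 := ℂ) x y

theorem inner_im_comm (x y : H) : (inner ℂ x y).im = -(inner ℂ y x).im :=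
  inner_im_symm (𝕜 := ℂ) x y

/-- A positive semidefinite 2×2 Hermitian matrix evaluated on a pair of vectors. Allowing complex c
is what later absorbs the commutator term into the form. -/
theorem quadratic_form_nonneg {a b : ℝ} {c : ℂ} (ha : 0 ≤ a) (hb : 0 ≤ b)
    (hc : ‖c‖ ^ 2 ≤ a * b) (x y : H) :
    0 ≤ a * ‖x‖ ^ 2 + b * ‖y‖ ^ 2 + 2 * (c * inner ℂ x y).re := by
  have h1 : -(‖c‖ * (‖x‖ * ‖y‖)) ≤ (c * inner ℂ x y).re := by
    have h2 := neg_le_of_abs_le (Complex.abs_re_le_norm (c * inner ℂ x y))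
    rw [norm_mul] at h2
    have h3 := mul_le_mul_of_nonneg_left (norm_inner_le_norm (𝕜 := ℂ) x y) (norm_nonneg c)
    linarith
  have h4 : 0 ≤ a * ‖x‖ ^ 2 + b * ‖y‖ ^ 2 - 2 * (‖c‖ * (‖x‖ * ‖y‖)) := by
    rcases ha.eq_or_lt with h0 | h0
    · have : ‖c‖ = 0 := by
        rw [← h0, zero_mul] at hc
        exact pow_eq_zero_iff (two_ne_zero) |>.1 (le_antisymm hc (sq_nonneg _))
      rw [this, ← h0]
      have := mul_nonneg hb (sq_nonneg ‖y‖)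
      linarith
    · by_contra! hneg
      have h5 : a * (a * ‖x‖ ^ 2 + b * ‖y‖ ^ 2 - 2 * (‖c‖ * (‖x‖ * ‖y‖)))
          = (a * ‖x‖ - ‖c‖ * ‖y‖) ^ 2 + (a * b - ‖c‖ ^ 2) * ‖y‖ ^ 2 := by ring
      have h6 := mul_neg_of_pos_of_neg h0 hneg
      have h7 := mul_nonneg (sub_nonneg.2 hc) (sq_nonneg ‖y‖)
      nlinarith [sq_nonneg (a * ‖x‖ - ‖c‖ * ‖y‖)]
  linarith

namespace IsCanonicalPair

variable {J : S →ₗ[ℂ] H} {P Q : S →ₗ[ℂ] S}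

theorem inner_self_im (h : IsCanonicalPair J P Q) (φ : S) :
    (inner ℂ (J (Q φ)) (J (P φ))).im = ‖J φ‖ ^ 2 / 2 := by
  have h1 := h.symm_right φ (P φ)
  have h2 := h.symm_left φ (Q φ)
  rw [h.comm, map_sub, map_smul, inner_sub_right, inner_smul_right, ← h1,
    inner_self_eq_norm_sq_to_K] at h2
  have h3 := congrArg Complex.im h2
  rw [inner_im_comm] at h3
  simp [← Complex.ofReal_pow] at h3
  linarith

theorem norm_sq_eq (h : IsCanonicalPair J P Q) (φ : S) :
    ‖J (P (Q φ))‖ ^ 2 = ‖J (Q (P φ))‖ ^ 2 := by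
  have h1 : (inner ℂ (J (Q (P φ))) (J φ)).im = -(‖J φ‖ ^ 2 / 2) := by
    rw [h.symm_right, inner_im_comm, h.inner_self_im]
  rw [h.comm, map_sub, map_smul, norm_sub_sq (𝕜 := ℂ), inner_smul_right]
  simp [norm_smul, h1]
  ring

/-- The quadratic form of `P² + Q²` is the energy. -/
theorem inner_energy (h : IsCanonicalPair J P Q) (φ : S) :
    inner ℂ (J (P (P φ) + Q (Q φ))) (J φ) = ((‖J (P φ)‖ ^ 2 + ‖J (Q φ)‖ ^ 2 : ℝ) : ℂ) := by
  rw [map_add, inner_add_left, h.symm_left, h.symm_right, inner_self_eq_norm_sq_to_K,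
    inner_self_eq_norm_sq_to_K]
  push_cast
  rfl

theorem inner_re_abs_le (φ : S) :
    |2 * (inner ℂ (J (Q φ)) (J (P φ))).re| ≤ ‖J (P φ)‖ ^ 2 + ‖J (Q φ)‖ ^ 2 := by
  have h1 := (Complex.abs_re_le_norm _).trans
    (norm_inner_le_norm (𝕜 := ℂ) (J (Q φ)) (J (P φ)))
  rw [abs_mul, abs_two]
  nlinarith [sq_nonneg (‖J (P φ)‖ - ‖J (Q φ)‖)]

/-- The uncertainty principle: ‖φ‖² = 2 Im⟨Q φ, P φ⟩, whence P² + Q² ≥ 1 as a form. -/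
theorem norm_sq_le_energy (h : IsCanonicalPair J P Q) (φ : S) :
    ‖J φ‖ ^ 2 ≤ ‖J (P φ)‖ ^ 2 + ‖J (Q φ)‖ ^ 2 := by
  have h0 := h.inner_self_im φ
  have h1 := (Complex.im_le_norm _).trans
    (norm_inner_le_norm (𝕜 := ℂ) (J (Q φ)) (J (P φ)))
  nlinarith [sq_nonneg (‖J (P φ)‖ - ‖J (Q φ)‖)]

theorem energy_le (h : IsCanonicalPair J P Q) (φ : S) :
    ‖J (P φ)‖ ^ 2 + ‖J (Q φ)‖ ^ 2 ≤ ‖J (P (P φ) + Q (Q φ))‖ * ‖J φ‖ := by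
  have h1 := norm_inner_le_norm (𝕜 := ℂ) (J (P (P φ) + Q (Q φ))) (J φ)
  rw [h.inner_energy, Complex.norm_real, Real.norm_of_nonneg (by positivity)] at h1
  exact h1

theorem norm_le (h : IsCanonicalPair J P Q) (φ : S) :
    ‖J φ‖ ≤ ‖J (P (P φ) + Q (Q φ))‖ := by
  have h1 := (h.norm_sq_le_energy φ).trans (h.energy_le φ)
  rcases (norm_nonneg (J φ)).eq_or_lt with h0 | h0
  · rw [← h0]; positivity
  · nlinarith

theorem energy_le_sq (h : IsCanonicalPair J P Q) (φ : S) :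
    ‖J (P φ)‖ ^ 2 + ‖J (Q φ)‖ ^ 2 ≤ ‖J (P (P φ) + Q (Q φ))‖ ^ 2 := by
  have := h.energy_le φ
  have := h.norm_le φ
  nlinarith [norm_nonneg (J (P (P φ) + Q (Q φ)))]

/-- Moving one Q across the product leaves ‖Q P φ‖² and commutator terms. Thus P² and Q² cannot
cancel in P² + Q², up to a multiple of ‖φ‖². -/
theorem inner_sq_sq (h : IsCanonicalPair J P Q) (φ : S) :
    inner ℂ (J (Q (Q φ))) (J (P (P φ))) = ((‖J (Q (P φ))‖ ^ 2 - ‖J φ‖ ^ 2 : ℝ) : ℂ)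
      + ((2 * (inner ℂ (J (Q φ)) (J (P φ))).re : ℝ) : ℂ) * Complex.I := by
  have hc : ∀ ψ, Q (P ψ) = P (Q ψ) + Complex.I • ψ := fun ψ => by rw [h.comm]; abel
  have e1 : inner ℂ (J (Q (Q φ))) (J (P (P φ)))
      = inner ℂ (J (Q (P φ))) (J (Q (P φ)))
        + 2 * Complex.I * inner ℂ (J (Q φ)) (J (P φ)) := by
    rw [h.symm_right, hc (P φ), map_add, map_smul, inner_add_right, inner_smul_right,
      ← h.symm_left, h.comm φ, map_sub, map_smul, inner_sub_left, inner_smul_left,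
      ← h.symm_right φ (P φ)]
    simp
    ring
  have h2 := h.inner_self_im φ
  rw [e1, inner_self_eq_norm_sq_to_K]
  apply Complex.ext
  · simp [← Complex.ofReal_pow, h2]
    ring
  · simp [← Complex.ofReal_pow]

theorem inner_mixed (h : IsCanonicalPair J P Q) (φ : S) :
    inner ℂ (J (P (P φ) + Q (Q φ))) (J (P (Q φ) + Q (P φ)))
      = ((2 * (inner ℂ (J (P (P φ))) (J (Q (P φ)))).re
          + 2 * (inner ℂ (J (P (Q φ))) (J (Q (Q φ)))).re : ℝ) : ℂ)
        + ((2 * (‖J (Q φ)‖ ^ 2 - ‖J (P φ)‖ ^ 2) : ℝ) : ℂ) * Complex.I := by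
  have hc : ∀ ψ, Q (P ψ) = P (Q ψ) + Complex.I • ψ := fun ψ => by rw [h.comm]; abel
  have e1 : inner ℂ (J (P (P φ))) (J (P (Q φ)))
      = inner ℂ (J (P (P φ))) (J (Q (P φ))) - Complex.I * (‖J (P φ)‖ ^ 2 : ℝ) := by
    rw [h.comm, map_sub, map_smul, inner_sub_right, inner_smul_right, h.symm_left (P φ) φ,
      inner_self_eq_norm_sq_to_K]
    push_cast; rfl
  have e2 : inner ℂ (J (Q (Q φ))) (J (Q (P φ)))
      = inner ℂ (J (Q (Q φ))) (J (P (Q φ))) + Complex.I * (‖J (Q φ)‖ ^ 2 : ℝ) := by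
    rw [hc, map_add, map_smul, inner_add_right, inner_smul_right, h.symm_right (Q φ) φ,
      inner_self_eq_norm_sq_to_K]
    push_cast; rfl
  have h1 := h.inner_self_im (P φ)
  have h2 := h.inner_self_im (Q φ)
  rw [map_add, map_add, inner_add_left, inner_add_right, inner_add_right, e1, e2]
  apply Complex.ext
  · simp [-Complex.ofReal_pow, inner_re_comm (J (P (Q φ))) (J (Q (Q φ)))]
    ring
  · simp [-Complex.ofReal_pow, inner_im_comm (J (P (P φ))) (J (Q (P φ))), h1, h2]
    ring

theorem norm_energy_sq (h : IsCanonicalPair J P Q) (φ : S) :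
    ‖J (P (P φ) + Q (Q φ))‖ ^ 2 = ‖J (P (P φ))‖ ^ 2 + ‖J (Q (Q φ))‖ ^ 2
      + 2 * ‖J (Q (P φ))‖ ^ 2 - 2 * ‖J φ‖ ^ 2 := by
  rw [map_add, add_comm (J (P (P φ))), norm_add_sq (𝕜 := ℂ), h.inner_sq_sq]
  simp [-Complex.ofReal_pow]
  ring

/-- All second order monomials are controlled by `P² + Q²`. -/
theorem second_order_le (h : IsCanonicalPair J P Q) (φ : S) :
    ‖J (P (P φ))‖ ^ 2 + ‖J (Q (Q φ))‖ ^ 2 + 2 * ‖J (Q (P φ))‖ ^ 2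
      ≤ 3 * ‖J (P (P φ) + Q (Q φ))‖ ^ 2 := by
  have h1 := h.norm_energy_sq φ
  have h2 := h.norm_le φ
  nlinarith [norm_nonneg (J φ)]

/-- Ellipticity of a quadratic operator whose symbol has real part at least `e (ξ² + x²)`. -/
theorem elliptic (h : IsCanonicalPair J P Q) {a b c : ℂ} {e : ℝ}
    (he : 0 ≤ e) (ha : e ≤ a.re) (hb : e ≤ b.re) (hc : c.re ^ 2 ≤ (a.re - e) * (b.re - e)) (φ : S) :
    e / 2 * ‖J (P (P φ) + Q (Q φ))‖ ^ 2
        - (a.re + b.re + |a.im - b.im| + 2 * |c.im|) * (‖J (P φ)‖ ^ 2 + ‖J (Q φ)‖ ^ 2)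
      ≤ (inner ℂ (J (P (P φ) + Q (Q φ)))
          (J (a • P (P φ) + b • Q (Q φ) + c • (P (Q φ) + Q (P φ))))).re := by
  -- The leading part, minus e times the second order norms, is the sum of the form with entries
  -- a.re - e, c.re, b.re - e evaluated at (P P φ, Q P φ) and at (P Q φ, Q Q φ). What remains comes
  -- from commutators and is controlled by the energy.
  have hcn : ‖((c.re : ℝ) : ℂ)‖ ^ 2 ≤ (a.re - e) * (b.re - e) := by
    rw [Complex.norm_real, Real.norm_eq_abs, sq_abs]; exact hc
  have q1 := quadratic_form_nonneg (sub_nonneg.2 ha) (sub_nonneg.2 hb) hcn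
    (J (P (P φ))) (J (Q (P φ)))
  have q2 := quadratic_form_nonneg (sub_nonneg.2 ha) (sub_nonneg.2 hb) hcn
    (J (P (Q φ))) (J (Q (Q φ)))
  rw [Complex.re_ofReal_mul] at q1 q2
  have hPQ := h.norm_sq_eq φ
  rw [hPQ] at q2
  have iPP : inner ℂ (J (P (P φ) + Q (Q φ))) (J (P (P φ)))
      = ((‖J (P (P φ))‖ ^ 2 + ‖J (Q (P φ))‖ ^ 2 - ‖J φ‖ ^ 2 : ℝ) : ℂ)
      + ((2 * (inner ℂ (J (Q φ)) (J (P φ))).re : ℝ) : ℂ) * Complex.I := by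
    rw [map_add, inner_add_left, h.inner_sq_sq, inner_self_eq_norm_sq_to_K]
    push_cast
    simp only [Complex.coe_algebraMap]
    ring
  have iQQ : inner ℂ (J (P (P φ) + Q (Q φ))) (J (Q (Q φ)))
      = ((‖J (Q (Q φ))‖ ^ 2 + ‖J (Q (P φ))‖ ^ 2 - ‖J φ‖ ^ 2 : ℝ) : ℂ)
      - ((2 * (inner ℂ (J (Q φ)) (J (P φ))).re : ℝ) : ℂ) * Complex.I := by
    rw [map_add, inner_add_left, ← inner_conj_symm (J (P (P φ))), h.inner_sq_sq,
      inner_self_eq_norm_sq_to_K, map_add, map_mul, Complex.conj_ofReal, Complex.conj_ofReal,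
      Complex.conj_I]
    push_cast
    simp only [Complex.coe_algebraMap]
    ring
  rw [map_add J (a • P (P φ) + b • Q (Q φ)), map_add J (a • P (P φ)), map_smul, map_smul, map_smul,
    inner_add_right, inner_add_right,
    inner_smul_right, inner_smul_right, inner_smul_right, iPP, iQQ, h.inner_mixed,
    h.norm_energy_sq]
  have hx := abs_le.1 (inner_re_abs_le (J := J) (P := P) (Q := Q) φ)
  have hn := h.norm_sq_le_energy φ
  have h3 : -(|a.im - b.im| * (‖J (P φ)‖ ^ 2 + ‖J (Q φ)‖ ^ 2))
      ≤ -((a.im - b.im) * (2 * (inner ℂ (J (Q φ)) (J (P φ))).re)) := by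
    apply neg_le_neg
    refine (le_abs_self _).trans ?_
    rw [abs_mul]
    gcongr
    exact inner_re_abs_le φ
  have h4 : -(|c.im| * (‖J (P φ)‖ ^ 2 + ‖J (Q φ)‖ ^ 2))
      ≤ -(c.im * (‖J (Q φ)‖ ^ 2 - ‖J (P φ)‖ ^ 2)) := by
    apply neg_le_neg
    refine (le_abs_self _).trans ?_
    rw [abs_mul]
    gcongr
    rw [abs_le]
    constructor <;> nlinarith [sq_nonneg ‖J (P φ)‖, sq_nonneg ‖J (Q φ)‖]
  have h5 : (a.re + b.re) * ‖J φ‖ ^ 2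
      ≤ (a.re + b.re) * (‖J (P φ)‖ ^ 2 + ‖J (Q φ)‖ ^ 2) := by
    gcongr
    linarith
  have h6 : 0 ≤ e * ‖J φ‖ ^ 2 := by positivity
  have h7 : 0 ≤ e * (‖J (P (P φ))‖ ^ 2 + ‖J (Q (Q φ))‖ ^ 2 + 2 * ‖J (Q (P φ))‖ ^ 2) := by
    positivity
  simp only [Complex.add_re, Complex.mul_re, Complex.ofReal_re, Complex.ofReal_im, Complex.I_re,
    Complex.I_im, Complex.sub_re, Complex.add_im, Complex.sub_im, Complex.mul_im]
  nlinarith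

/-- The real part of the quadratic form of a quadratic operator. -/
theorem inner_quadratic_re (h : IsCanonicalPair J P Q) (a b c : ℂ) (φ : S) :
    (inner ℂ (J φ) (J (a • P (P φ) + b • Q (Q φ) + c • (P (Q φ) + Q (P φ))))).re
      = a.re * ‖J (P φ)‖ ^ 2 + b.re * ‖J (Q φ)‖ ^ 2
        + 2 * c.re * (inner ℂ (J (P φ)) (J (Q φ))).re := by
  rw [map_add, map_add, map_smul, map_smul, map_smul, inner_add_right, inner_add_right,
    inner_smul_right, inner_smul_right, inner_smul_right, map_add, inner_add_right,
    ← h.symm_left φ (P φ), ← h.symm_right φ (Q φ), ← h.symm_left φ (Q φ),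
    ← h.symm_right φ (P φ),
    inner_self_eq_norm_sq_to_K, inner_self_eq_norm_sq_to_K]
  simp [← Complex.ofReal_pow, inner_re_comm (J (Q φ)) (J (P φ)),
    inner_im_comm (J (Q φ)) (J (P φ))]
  ring

end IsCanonicalPair

end CanonicalPair

end QFP

namespace QFP

/-! ### Position and momentum on Schwartz functions -/

section Schwartz

/-- The momentum operator `-i d/dx` on Schwartz functions. -/
noncomputable def schwartzMom : 𝓢(ℝ, ℂ) →ₗ[ℂ] 𝓢(ℝ, ℂ) :=
  (-Complex.I) • (SchwartzMap.derivCLM ℂ ℂ : 𝓢(ℝ, ℂ) →L[ℂ] 𝓢(ℝ, ℂ)).toLinearMap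

/-- The position operator on Schwartz functions. -/
noncomputable def schwartzPos : 𝓢(ℝ, ℂ) →ₗ[ℂ] 𝓢(ℝ, ℂ) :=
  (SchwartzMap.smulLeftCLM ℂ (fun x : ℝ => (x : ℂ))).toLinearMap

/-- The embedding of Schwartz functions into `L²(ℝ)`. -/
noncomputable def schwartzToL2 : 𝓢(ℝ, ℂ) →ₗ[ℂ] L2R :=
  (SchwartzMap.toLpCLM ℂ ℂ 2 (volume : Measure ℝ)).toLinearMap

theorem schwartzMom_apply (φ : 𝓢(ℝ, ℂ)) (x : ℝ) :
    schwartzMom φ x = -Complex.I * deriv φ x := rfl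

theorem schwartzPos_apply (φ : 𝓢(ℝ, ℂ)) (x : ℝ) : schwartzPos φ x = x * φ x := by
  have h : Function.HasTemperateGrowth (fun x : ℝ => (x : ℂ)) := by fun_prop
  exact SchwartzMap.smulLeftCLM_apply_apply h φ x

theorem coeFn_schwartzToL2 (φ : 𝓢(ℝ, ℂ)) : schwartzToL2 φ =ᵐ[volume] φ :=
  φ.coeFn_toLp 2 volume

theorem denseRange_schwartzToL2 : DenseRange schwartzToL2 :=
  SchwartzMap.denseRange_toLpCLM (by simp)

theorem inner_schwartzToL2 (φ : 𝓢(ℝ, ℂ)) (u : L2R) :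
    inner ℂ (schwartzToL2 φ) u = ∫ x, (starRingEnd ℂ) (φ x) * u x := by
  rw [L2.inner_def]
  refine integral_congr_ae ?_
  filter_upwards [coeFn_schwartzToL2 φ] with x hx
  rw [hx, RCLike.inner_apply, mul_comm]

theorem inner_schwartzToL2_schwartzToL2 (φ ψ : 𝓢(ℝ, ℂ)) :
    inner ℂ (schwartzToL2 φ) (schwartzToL2 ψ) = ∫ x, (starRingEnd ℂ) (φ x) * ψ x := by
  rw [inner_schwartzToL2]
  refine integral_congr_ae ?_
  filter_upwards [coeFn_schwartzToL2 ψ] with x hx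
  rw [hx]

/-- The complex conjugate of a Schwartz function. -/
noncomputable def schwartzConj (φ : 𝓢(ℝ, ℂ)) : 𝓢(ℝ, ℂ) :=
  SchwartzMap.postcompCLM (𝕜 := ℝ) (Complex.conjCLE : ℂ →L[ℝ] ℂ) φ

theorem schwartzConj_apply (φ : 𝓢(ℝ, ℂ)) (x : ℝ) :
    schwartzConj φ x = (starRingEnd ℂ) (φ x) := rfl

theorem deriv_schwartzConj (φ : 𝓢(ℝ, ℂ)) (x : ℝ) :
    deriv (schwartzConj φ) x = (starRingEnd ℂ) (deriv φ x) :=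
  (((Complex.conjCLE : ℂ →L[ℝ] ℂ).hasFDerivAt.comp_hasDerivAt x (φ.hasDerivAt x))).deriv

theorem schwartzConj_schwartzConj (φ : 𝓢(ℝ, ℂ)) : schwartzConj (schwartzConj φ) = φ := by
  ext x
  simp [schwartzConj_apply]

theorem isCanonicalPair_schwartz : IsCanonicalPair schwartzToL2 schwartzMom schwartzPos where
  symm_left φ ψ := by
    rw [inner_schwartzToL2_schwartzToL2, inner_schwartzToL2_schwartzToL2]
    have h := SchwartzMap.integral_mul_deriv_eq_neg_deriv_mul (schwartzConj φ) ψ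
    simp only [deriv_schwartzConj, schwartzConj_apply] at h
    calc _ = Complex.I * ∫ x, (starRingEnd ℂ) (deriv φ x) * ψ x := by
          rw [← integral_const_mul]
          refine integral_congr_ae (ae_of_all _ fun x => ?_)
          simp [schwartzMom_apply]; ring
      _ = -Complex.I * ∫ x, (starRingEnd ℂ) (φ x) * deriv ψ x := by rw [h]; ring
      _ = _ := by
          rw [← integral_const_mul]
          refine integral_congr_ae (ae_of_all _ fun x => ?_)
          simp [schwartzMom_apply]; ring
  symm_right φ ψ := by
    rw [inner_schwartzToL2_schwartzToL2, inner_schwartzToL2_schwartzToL2]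
    refine integral_congr_ae (ae_of_all _ fun x => ?_)
    simp [schwartzPos_apply]; ring
  comm φ := by
    ext x
    have h : HasDerivAt (schwartzPos φ) (1 * φ x + x * deriv φ x) x := by
      have e : (schwartzPos φ : ℝ → ℂ) = fun x : ℝ => (x : ℂ) * φ x :=
        funext (schwartzPos_apply φ)
      rw [e]
      exact (Complex.ofRealCLM.hasDerivAt (x := x)).mul (φ.hasDerivAt x)
    change schwartzMom (schwartzPos φ) x = schwartzPos (schwartzMom φ) x - Complex.I * φ x
    rw [schwartzMom_apply, schwartzPos_apply, schwartzMom_apply, h.deriv]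
    ring

/-- The momentum operator is the adjoint of its restriction to Schwartz functions. -/
theorem mem_graph_momOp_iff_inner (u g : L2R) : (u, g) ∈ momOp.graph ↔
    ∀ φ, inner ℂ (schwartzToL2 (schwartzMom φ)) u = inner ℂ (schwartzToL2 φ) g := by
  -- The distributional pairing is bilinear and the inner product is not, so the test function is
  -- conjugated.
  have key : ∀ φ : 𝓢(ℝ, ℂ),
      (TemperedDistribution.derivCLM ℂ (toDistr u) (schwartzConj φ)
        = toDistr (Complex.I • g) (schwartzConj φ)) ↔
      inner ℂ (schwartzToL2 (schwartzMom φ)) u = inner ℂ (schwartzToL2 φ) g := by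
    intro φ
    rw [TemperedDistribution.derivCLM_apply_apply, map_smul,
      Lp.toTemperedDistributionCLM_apply, Lp.toTemperedDistributionCLM_apply,
      smul_apply, Lp.toTemperedDistribution_apply,
      Lp.toTemperedDistribution_apply]
    have e1 : ∫ x, (-SchwartzMap.derivCLM ℂ ℂ (schwartzConj φ)) x • u x
        = Complex.I * inner ℂ (schwartzToL2 (schwartzMom φ)) u := by
      rw [inner_schwartzToL2, ← integral_const_mul]
      refine integral_congr_ae (ae_of_all _ fun x => ?_)
      simp only [neg_apply, SchwartzMap.derivCLM_apply, deriv_schwartzConj,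
        schwartzMom_apply, smul_eq_mul, map_mul, map_neg, Complex.conj_I]
      linear_combination (-(starRingEnd ℂ) (deriv φ x) * u x) * Complex.I_mul_I
    have e2 : ∫ x, schwartzConj φ x • g x = inner ℂ (schwartzToL2 φ) g := by
      rw [inner_schwartzToL2]
      rfl
    rw [e1, e2, smul_eq_mul]
    exact mul_right_inj' Complex.I_ne_zero
  rw [mem_graph_momOp]
  constructor
  · intro h φ
    exact (key φ).1 (by rw [h])
  · intro h
    ext φ
    have := (key (schwartzConj φ)).2 (h _)
    rwa [schwartzConj_schwartzConj] at this

theorem inner_schwartzPos (φ : 𝓢(ℝ, ℂ)) (u : L2R) :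
    inner ℂ (schwartzToL2 (schwartzPos φ)) u = ∫ x : ℝ, (starRingEnd ℂ) (φ x) * (x * u x) := by
  rw [inner_schwartzToL2]
  refine integral_congr_ae (ae_of_all _ fun x => ?_)
  simp [schwartzPos_apply]; ring

/-- The position operator is the adjoint of its restriction to Schwartz functions. -/
theorem mem_graph_posOp_iff_inner (u g : L2R) : (u, g) ∈ posOp.graph ↔
    ∀ φ, inner ℂ (schwartzToL2 (schwartzPos φ)) u = inner ℂ (schwartzToL2 φ) g := by
  rw [posOp, mem_graph_mulOp]
  constructor
  · intro h φ
    rw [inner_schwartzPos, inner_schwartzToL2]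
    refine integral_congr_ae ?_
    filter_upwards [h] with x hx
    rw [hx]
  · intro h
    have hg : LocallyIntegrable g (volume : Measure ℝ) :=
      (Lp.memLp g).locallyIntegrable one_le_two
    have hu : LocallyIntegrable (fun x : ℝ => (x : ℂ) * u x) (volume : Measure ℝ) := by
      rw [locallyIntegrable_iff]
      intro K hK
      exact (((Lp.memLp u).locallyIntegrable one_le_two).integrableOn_isCompact hK).continuousOn_mul
        (Complex.continuous_ofReal.continuousOn) hK
    refine ae_eq_of_integral_contDiff_smul_eq hg hu fun ψ hψ hc => ?_
    have hg₁ : HasCompactSupport (Complex.ofRealCLM ∘ ψ) := hc.comp_left rfl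
    have hg₂ : ContDiff ℝ ((⊤ : ℕ∞) : WithTop ℕ∞) (Complex.ofRealCLM ∘ ψ) :=
      Complex.ofRealCLM.contDiff.comp hψ
    have h1 := h (hg₁.toSchwartzMap hg₂)
    rw [inner_schwartzPos, inner_schwartzToL2] at h1
    simpa using h1.symm

end Schwartz

end QFP

namespace QFP

/-! ### Density of the range of P² + Q², by Hermite-type functions -/

section Hermite

theorem exists_bound_pow_mul_exp_neg_sq (k : ℕ) :
    ∃ C : ℝ, ∀ x : ℝ, |x| ^ k * Real.exp (-(x ^ 2 / 2)) ≤ C := by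
  refine ⟨(k.factorial : ℝ) * Real.exp (1 / 2), fun x => ?_⟩
  have h1 : |x| ^ k ≤ k.factorial * Real.exp |x| := by
    have := Real.pow_div_factorial_le_exp |x| (abs_nonneg x) k
    rwa [div_le_iff₀ (by positivity), mul_comm] at this
  calc |x| ^ k * Real.exp (-(x ^ 2 / 2))
      ≤ k.factorial * Real.exp |x| * Real.exp (-(x ^ 2 / 2)) := by gcongr
    _ = k.factorial * Real.exp (|x| - x ^ 2 / 2) := by
        rw [mul_assoc, ← Real.exp_add]; rfl
    _ ≤ _ := by
        gcongr
        nlinarith [sq_nonneg (|x| - 1), sq_abs x]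

theorem exists_bound_polynomial_mul_exp_neg_sq (p : Polynomial ℝ) (k : ℕ) :
    ∃ C : ℝ, ∀ x : ℝ, |x| ^ k * (|p.eval x| * Real.exp (-(x ^ 2 / 2))) ≤ C := by
  induction p using Polynomial.induction_on' with
  | add p q hp hq =>
    obtain ⟨C, hC⟩ := hp
    obtain ⟨D, hD⟩ := hq
    refine ⟨C + D, fun x => ?_⟩
    rw [Polynomial.eval_add]
    calc _ ≤ |x| ^ k * ((|p.eval x| + |q.eval x|) * Real.exp (-(x ^ 2 / 2))) := by
          gcongr; exact abs_add_le _ _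
      _ = |x| ^ k * (|p.eval x| * Real.exp (-(x ^ 2 / 2)))
          + |x| ^ k * (|q.eval x| * Real.exp (-(x ^ 2 / 2))) := by ring
      _ ≤ _ := add_le_add (hC x) (hD x)
  | monomial n a =>
    obtain ⟨C, hC⟩ := exists_bound_pow_mul_exp_neg_sq (k + n)
    refine ⟨|a| * C, fun x => ?_⟩
    rw [Polynomial.eval_monomial, abs_mul, abs_pow]
    calc _ = |a| * (|x| ^ (k + n) * Real.exp (-(x ^ 2 / 2))) := by ring
      _ ≤ _ := by gcongr; exact hC x

/-- The Gaussian `exp (-x² / 2)` as a real Schwartz function. -/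
noncomputable def realGaussian : 𝓢(ℝ, ℝ) where
  toFun x := Real.exp (-(x ^ 2 / 2))
  smooth' := by fun_prop
  decay' k n := by
    obtain ⟨C, hC⟩ := exists_bound_polynomial_mul_exp_neg_sq
      ((Polynomial.hermite n).map (Int.castRingHom ℝ)) k
    refine ⟨C, fun x => ?_⟩
    rw [norm_iteratedFDeriv_eq_norm_iteratedDeriv, iteratedDeriv_eq_iterate,
      Polynomial.deriv_gaussian_eq_hermite_mul_gaussian, Real.norm_eq_abs, Real.norm_eq_abs,
      abs_mul, abs_mul, abs_pow, abs_neg, abs_one, one_pow, one_mul, Real.abs_exp]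
    have h := hC x
    rwa [Polynomial.eval_map, ← algebraMap_int_eq, ← Polynomial.aeval_def] at h

/-- The Gaussian `exp (-x² / 2)` as a complex Schwartz function. -/
noncomputable def gaussian : 𝓢(ℝ, ℂ) :=
  SchwartzMap.postcompCLM (𝕜 := ℝ) Complex.ofRealCLM realGaussian

theorem gaussian_apply (x : ℝ) : gaussian x = ((Real.exp (-(x ^ 2 / 2)) : ℝ) : ℂ) := rfl

theorem schwartzMom_gaussian : schwartzMom gaussian = Complex.I • schwartzPos gaussian := by
  ext x
  have h : HasDerivAt gaussian (((Real.exp (-(x ^ 2 / 2)) * (-x) : ℝ)) : ℂ) x := by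
    have h1 : HasDerivAt (fun y : ℝ => -(y ^ 2 / 2)) (-x) x := by
      have := ((hasDerivAt_pow 2 x).div_const 2).neg
      refine this.congr_deriv ?_
      norm_num
    exact h1.exp.ofReal_comp
  change schwartzMom gaussian x = Complex.I * schwartzPos gaussian x
  rw [schwartzMom_apply, schwartzPos_apply, h.deriv, gaussian_apply]
  push_cast
  ring

theorem schwartzPos_pow_apply (k : ℕ) (φ : 𝓢(ℝ, ℂ)) (x : ℝ) :
    (schwartzPos ^ k) φ x = (x : ℂ) ^ k * φ x := by
  induction k with
  | zero => simp
  | succ k ih => rw [pow_succ', Module.End.mul_apply, schwartzPos_apply, ih]; ring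

/-- The truncated exponent k - 1 at k = 0 is harmless, as its coefficient vanishes there. -/
theorem schwartzMom_pow_gaussian (k : ℕ) :
    schwartzMom ((schwartzPos ^ k) gaussian)
      = Complex.I • (schwartzPos ^ (k + 1)) gaussian
        - (Complex.I * k) • (schwartzPos ^ (k - 1)) gaussian := by
  induction k with
  | zero => simp [schwartzMom_gaussian]
  | succ k ih =>
    rw [pow_succ' _ k, Module.End.mul_apply, isCanonicalPair_schwartz.comm, ih, map_sub, map_smul,
      map_smul]
    have e : (Complex.I * k) • schwartzPos ((schwartzPos ^ (k - 1)) gaussian)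
        = (Complex.I * k) • (schwartzPos ^ k) gaussian := by
      rcases k with _ | k
      · simp
      · rw [Nat.add_sub_cancel, pow_succ' _ k, Module.End.mul_apply]
    rw [e, ← Module.End.mul_apply, ← pow_succ', Nat.add_sub_cancel]
    push_cast
    module

/-- The operator `P² + Q²` is triangular on the functions `x ^ k exp (-x² / 2)`. -/
theorem energy_pow_gaussian (k : ℕ) :
    schwartzMom (schwartzMom ((schwartzPos ^ k) gaussian))
        + schwartzPos (schwartzPos ((schwartzPos ^ k) gaussian))
      = (2 * k + 1 : ℂ) • (schwartzPos ^ k) gaussian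
        - (k * ((k - 1 : ℕ) : ℂ)) • (schwartzPos ^ (k - 2)) gaussian := by
  have hq : schwartzPos (schwartzPos ((schwartzPos ^ k) gaussian))
      = (schwartzPos ^ (k + 2)) gaussian := by
    rw [pow_succ' _ (k + 1), pow_succ' _ k]; rfl
  rw [hq, schwartzMom_pow_gaussian, map_sub, map_smul, map_smul, schwartzMom_pow_gaussian,
    schwartzMom_pow_gaussian]
  simp only [Nat.add_sub_cancel, smul_sub, smul_smul]
  have h1 : k - 1 - 1 = k - 2 := by omega
  have h2 : (Complex.I * k * Complex.I) • (schwartzPos ^ (k - 1 + 1)) gaussian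
      = (-(k : ℂ)) • (schwartzPos ^ k) gaussian := by
    rcases k with _ | k
    · simp
    · rw [Nat.add_sub_cancel]
      congr 1
      linear_combination (((k + 1 : ℕ) : ℂ)) * Complex.I_mul_I
  have h3 : Complex.I * k * (Complex.I * ((k - 1 : ℕ) : ℂ)) = -(k * ((k - 1 : ℕ) : ℂ)) := by
    linear_combination (k * ((k - 1 : ℕ) : ℂ)) * Complex.I_mul_I
  have h4 : Complex.I * (Complex.I * ((k + 1 : ℕ) : ℂ)) = -((k + 1 : ℕ) : ℂ) := by
    linear_combination (((k + 1 : ℕ) : ℂ)) * Complex.I_mul_I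
  rw [h1, h2, h3, h4, Complex.I_mul_I]
  push_cast
  module

/-- The product exp |t x| exp (-x² / 2) is square integrable because 2 |t x| ≤ 2 t² + x² / 2; its
product with |f| is then integrable. -/
theorem integrable_exp_mul_gaussian_mul (t : ℝ) (f : L2R) :
    Integrable (fun x : ℝ => Real.exp (|t * x|) * ‖Real.exp (-(x ^ 2 / 2)) * f x‖) := by
  have h1 : MemLp (fun x : ℝ => Real.exp (|t * x|) * Real.exp (-(x ^ 2 / 2))) 2 volume := by
    rw [memLp_two_iff_integrable_sq (by fun_prop)]
    refine ((integrable_exp_neg_mul_sq (b := 1 / 2) (by norm_num)).const_mul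
      (Real.exp (2 * t ^ 2))).mono' (by fun_prop) (ae_of_all _ fun x => ?_)
    rw [← Real.exp_add, ← Real.exp_add, ← Real.exp_nat_mul, Real.norm_eq_abs, Real.abs_exp]
    apply Real.exp_le_exp.2
    rw [abs_mul]
    push_cast
    nlinarith [sq_nonneg (2 * |t| - |x|), sq_abs t, sq_abs x]
  have h2 := h1.integrable_mul (Lp.memLp f).norm
  refine h2.congr (ae_of_all _ fun x => ?_)
  simp only [Pi.mul_apply, norm_mul, Complex.norm_real, Real.norm_eq_abs, Real.abs_exp]
  ring

/-- The exponential is expanded in its power series, each term being a multiple of a vanishing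
moment; exp |t x| dominates the sum. -/
theorem integral_cexp_mul_eq_zero {f : L2R}
    (hf : ∀ k : ℕ, ∫ x : ℝ, (x : ℂ) ^ k * (Real.exp (-(x ^ 2 / 2)) * f x) = 0) (t : ℝ) :
    ∫ x : ℝ, Complex.exp (t * x * Complex.I) * (Real.exp (-(x ^ 2 / 2)) * f x) = 0 := by
  have hmeas : AEStronglyMeasurable (fun x : ℝ => (Real.exp (-(x ^ 2 / 2)) : ℂ) * f x) volume := by
    refine AEStronglyMeasurable.mul ?_ (Lp.memLp f).1
    exact Continuous.aestronglyMeasurable (by fun_prop)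
  have hs : ∀ x : ℝ, HasSum (fun n : ℕ => |t * x| ^ n / n.factorial
      * ‖(Real.exp (-(x ^ 2 / 2)) : ℂ) * f x‖)
      (Real.exp |t * x| * ‖(Real.exp (-(x ^ 2 / 2)) : ℂ) * f x‖) := fun x => by
    refine HasSum.mul_right _ ?_
    rw [Real.exp_eq_exp_ℝ]
    exact NormedSpace.expSeries_div_hasSum_exp _
  have hd := hasSum_integral_of_dominated_convergence (μ := (volume : Measure ℝ))
    (F := fun (n : ℕ) (x : ℝ) => ((t * x * Complex.I) ^ n / n.factorial)
      * ((Real.exp (-(x ^ 2 / 2)) : ℂ) * f x))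
    (f := fun x : ℝ => Complex.exp (t * x * Complex.I) * (Real.exp (-(x ^ 2 / 2)) * f x))
    (fun (n : ℕ) (x : ℝ) => |t * x| ^ n / n.factorial * ‖(Real.exp (-(x ^ 2 / 2)) : ℂ) * f x‖)
    (fun n => AEStronglyMeasurable.mul (Continuous.aestronglyMeasurable (by fun_prop)) hmeas)
    (fun n => ae_of_all _ fun x => by
      rw [norm_mul, norm_div, norm_pow, norm_mul, Complex.norm_I, mul_one, norm_mul,
        Complex.norm_real, Complex.norm_real, Real.norm_eq_abs, Real.norm_eq_abs, abs_mul,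
        Complex.norm_natCast])
    (ae_of_all _ fun x => (hs x).summable)
    (by
      have : (fun x : ℝ => ∑' n : ℕ, |t * x| ^ n / n.factorial
          * ‖(Real.exp (-(x ^ 2 / 2)) : ℂ) * f x‖)
          = fun x : ℝ => Real.exp |t * x| * ‖(Real.exp (-(x ^ 2 / 2)) : ℂ) * f x‖ :=
        funext fun x => (hs x).tsum_eq
      rw [this]
      exact integrable_exp_mul_gaussian_mul t f)
    (ae_of_all _ fun x => by
      refine HasSum.mul_right _ ?_
      rw [Complex.exp_eq_exp_ℂ]
      exact NormedSpace.expSeries_div_hasSum_exp _)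
  refine hd.unique ?_
  have e : ∀ n : ℕ, ∫ x : ℝ, ((t * x * Complex.I) ^ n / n.factorial)
      * ((Real.exp (-(x ^ 2 / 2)) : ℂ) * f x) = 0 := by
    intro n
    have h1 := congrArg (fun z => ((t * Complex.I) ^ n / n.factorial) * z) (hf n)
    simp only [mul_zero] at h1
    rw [← integral_const_mul] at h1
    rw [← h1]
    refine integral_congr_ae (ae_of_all _ fun x => ?_)
    simp only [mul_pow]
    ring
  simp only [e]
  exact hasSum_zero

/-- The functions `x ^ k exp (-x² / 2)` are total in `L²(ℝ)`. -/
theorem eq_zero_of_inner_pow_gaussian {f : L2R}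
    (hf : ∀ k : ℕ, inner ℂ (schwartzToL2 ((schwartzPos ^ k) gaussian)) f = 0) : f = 0 := by
  have hm : ∀ k : ℕ, ∫ x : ℝ, (x : ℂ) ^ k * (Real.exp (-(x ^ 2 / 2)) * f x) = 0 := by
    intro k
    rw [← hf k, inner_schwartzToL2]
    refine integral_congr_ae (ae_of_all _ fun x => ?_)
    simp only [schwartzPos_pow_apply, gaussian_apply, map_mul, map_pow, Complex.conj_ofReal]
    ring
  set h : ℝ → ℂ := fun x => Real.exp (-(x ^ 2 / 2)) * f x with hh
  have hint : Integrable h := by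
    have h0 := integrable_exp_mul_gaussian_mul 0 f
    simp only [zero_mul, abs_zero, Real.exp_zero, one_mul] at h0
    refine (integrable_norm_iff ?_).1 h0
    refine AEStronglyMeasurable.mul ?_ (Lp.memLp f).1
    exact Continuous.aestronglyMeasurable (by fun_prop)
  -- Vanishing moments kill the Fourier transform of exp (-x² / 2) f. Moving the transform onto test
  -- functions then shows that this function is zero almost everywhere.
  have hF : ∀ ξ : ℝ, FourierTransform.fourier h ξ = 0 := by
    intro ξ
    rw [Real.fourier_eq']
    rw [← integral_cexp_mul_eq_zero hm (-2 * Real.pi * ξ)]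
    refine integral_congr_ae (ae_of_all _ fun x => ?_)
    simp only [smul_eq_mul, hh]
    congr 2
    simp
    ring
  have h0 : ∀ᵐ x : ℝ, h x = 0 := by
    refine ae_eq_zero_of_integral_contDiff_smul_eq_zero hint.locallyIntegrable fun ψ hψ hc => ?_
    have hg₁ : HasCompactSupport (Complex.ofRealCLM ∘ ψ) := hc.comp_left rfl
    have hg₂ : ContDiff ℝ ((⊤ : ℕ∞) : WithTop ℕ∞) (Complex.ofRealCLM ∘ ψ) :=
      Complex.ofRealCLM.contDiff.comp hψ
    set φ : 𝓢(ℝ, ℂ) := hg₁.toSchwartzMap hg₂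
    have e := VectorFourier.integral_fourierIntegral_smul_eq_flip (L := innerₗ ℝ)
      (μ := (volume : Measure ℝ)) (ν := (volume : Measure ℝ))
      Real.continuous_fourierChar continuous_inner hint
      (FourierTransformInv.fourierInv φ).integrable
    have e1 : ∀ x, FourierTransform.fourier (FourierTransformInv.fourierInv φ) x = φ x := fun x => by
      rw [FourierTransform.fourier_fourierInv_eq]
    calc ∫ x, ψ x • h x = ∫ x, h x • φ x := by
          refine integral_congr_ae (ae_of_all _ fun x => ?_)
          simp [φ, mul_comm]
      _ = ∫ x, h x • FourierTransform.fourier (FourierTransformInv.fourierInv φ) x := by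
          simp only [e1]
      _ = ∫ x, FourierTransform.fourier h x • FourierTransformInv.fourierInv φ x := by
          rw [flip_innerₗ] at e
          exact e.symm
      _ = 0 := by simp [hF]
  refine Lp.ext ?_
  filter_upwards [h0, Lp.coeFn_zero ℂ 2 (volume : Measure ℝ)] with x hx hz
  rw [hz]
  have h2 : (Real.exp (-(x ^ 2 / 2)) : ℂ) ≠ 0 := by
    exact_mod_cast (Real.exp_pos _).ne'
  exact (mul_eq_zero.1 hx).resolve_left h2

/-- The range of `P² + Q²` on Schwartz functions, as a linear map into `L²(ℝ)`. -/
noncomputable def schwartzEnergy : 𝓢(ℝ, ℂ) →ₗ[ℂ] L2R :=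
  schwartzToL2 ∘ₗ (schwartzMom ∘ₗ schwartzMom + schwartzPos ∘ₗ schwartzPos)

theorem schwartzEnergy_apply (φ : 𝓢(ℝ, ℂ)) : schwartzEnergy φ
    = schwartzToL2 (schwartzMom (schwartzMom φ) + schwartzPos (schwartzPos φ)) := rfl

/-- By triangularity, strong induction on k gives (2 k + 1)⟨x ^ k exp (-x² / 2), f⟩ = 0; the
diagonal entry never vanishes and these functions are total. -/
theorem eq_zero_of_inner_schwartzEnergy {f : L2R}
    (hf : ∀ φ, inner ℂ (schwartzEnergy φ) f = 0) : f = 0 := by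
  refine eq_zero_of_inner_pow_gaussian fun k => ?_
  induction k using Nat.strong_induction_on with
  | _ k ih =>
    have h := hf ((schwartzPos ^ k) gaussian)
    rw [schwartzEnergy_apply, energy_pow_gaussian, map_sub, map_smul, map_smul, inner_sub_left,
      inner_smul_left, inner_smul_left] at h
    have h2 : (starRingEnd ℂ) (k * ((k - 1 : ℕ) : ℂ))
        * inner ℂ (schwartzToL2 ((schwartzPos ^ (k - 2)) gaussian)) f = 0 := by
      rcases k with _ | k
      · simp
      · rw [ih (k + 1 - 2) (by omega), mul_zero]
    rw [h2, sub_zero] at h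
    refine (mul_eq_zero.1 h).resolve_left ?_
    rw [map_eq_zero]
    exact_mod_cast Nat.succ_ne_zero (2 * k)

theorem denseRange_schwartzEnergy : DenseRange schwartzEnergy := by
  have h : (LinearMap.range schwartzEnergy)ᗮ = ⊥ := by
    rw [Submodule.eq_bot_iff]
    intro f hf
    exact eq_zero_of_inner_schwartzEnergy fun φ => hf _ ⟨φ, rfl⟩
  have h2 := (Submodule.topologicalClosure_eq_top_iff).2 h
  have h3 := (Submodule.dense_iff_topologicalClosure_eq_top).2 h2
  exact h3

end Hermite

end QFP

namespace QFP

/-! ### Bounded operators Z (P² + Q²)⁻¹ on L²(ℝ) -/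

section Extension

/-- Operators on Schwartz functions that are bounded relative to `P² + Q²`. -/
def IsEnergyBounded (Z : 𝓢(ℝ, ℂ) →ₗ[ℂ] 𝓢(ℝ, ℂ)) : Prop :=
  ∃ C, ∀ φ, ‖(schwartzToL2 ∘ₗ Z) φ‖ ≤ C * ‖schwartzEnergy φ‖

/-- The bounded operator extending `Z (P² + Q²)⁻¹` to `L²(ℝ)`. -/
noncomputable def mulInvEnergy (Z : 𝓢(ℝ, ℂ) →ₗ[ℂ] 𝓢(ℝ, ℂ)) : L2R →L[ℂ] L2R :=
  (schwartzToL2 ∘ₗ Z).extendOfNorm schwartzEnergy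

theorem mulInvEnergy_schwartzEnergy {Z : 𝓢(ℝ, ℂ) →ₗ[ℂ] 𝓢(ℝ, ℂ)} (hZ : IsEnergyBounded Z)
    (φ : 𝓢(ℝ, ℂ)) : mulInvEnergy Z (schwartzEnergy φ) = schwartzToL2 (Z φ) :=
  LinearMap.extendOfNorm_eq denseRange_schwartzEnergy hZ φ

theorem isEnergyBounded_id : IsEnergyBounded LinearMap.id :=
  ⟨1, fun φ => (isCanonicalPair_schwartz.norm_le φ).trans_eq (one_mul _).symm⟩

theorem isEnergyBounded_mom : IsEnergyBounded schwartzMom :=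
  ⟨1, fun φ => by
    rw [one_mul]
    refine le_of_sq_le_sq ?_ (norm_nonneg _)
    have := isCanonicalPair_schwartz.energy_le_sq φ
    change ‖schwartzToL2 (schwartzMom φ)‖ ^ 2 ≤ _
    rw [schwartzEnergy_apply]
    nlinarith [sq_nonneg ‖schwartzToL2 (schwartzPos φ)‖]⟩

theorem isEnergyBounded_pos : IsEnergyBounded schwartzPos :=
  ⟨1, fun φ => by
    rw [one_mul]
    refine le_of_sq_le_sq ?_ (norm_nonneg _)
    have := isCanonicalPair_schwartz.energy_le_sq φ
    change ‖schwartzToL2 (schwartzPos φ)‖ ^ 2 ≤ _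
    rw [schwartzEnergy_apply]
    nlinarith [sq_nonneg ‖schwartzToL2 (schwartzMom φ)‖]⟩

theorem isEnergyBounded_mom_mom : IsEnergyBounded (schwartzMom ∘ₗ schwartzMom) :=
  ⟨2, fun φ => by
    refine le_of_sq_le_sq ?_ (by positivity)
    have := isCanonicalPair_schwartz.second_order_le φ
    change ‖schwartzToL2 (schwartzMom (schwartzMom φ))‖ ^ 2 ≤ _
    rw [schwartzEnergy_apply]
    nlinarith [sq_nonneg ‖schwartzToL2 (schwartzPos (schwartzPos φ))‖,
      sq_nonneg ‖schwartzToL2 (schwartzPos (schwartzMom φ))‖]⟩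

theorem isEnergyBounded_pos_pos : IsEnergyBounded (schwartzPos ∘ₗ schwartzPos) :=
  ⟨2, fun φ => by
    refine le_of_sq_le_sq ?_ (by positivity)
    have := isCanonicalPair_schwartz.second_order_le φ
    change ‖schwartzToL2 (schwartzPos (schwartzPos φ))‖ ^ 2 ≤ _
    rw [schwartzEnergy_apply]
    nlinarith [sq_nonneg ‖schwartzToL2 (schwartzMom (schwartzMom φ))‖,
      sq_nonneg ‖schwartzToL2 (schwartzPos (schwartzMom φ))‖]⟩

theorem isEnergyBounded_pos_mom : IsEnergyBounded (schwartzPos ∘ₗ schwartzMom) :=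
  ⟨2, fun φ => by
    refine le_of_sq_le_sq ?_ (by positivity)
    have := isCanonicalPair_schwartz.second_order_le φ
    change ‖schwartzToL2 (schwartzPos (schwartzMom φ))‖ ^ 2 ≤ _
    rw [schwartzEnergy_apply]
    nlinarith [sq_nonneg ‖schwartzToL2 (schwartzMom (schwartzMom φ))‖,
      sq_nonneg ‖schwartzToL2 (schwartzPos (schwartzPos φ))‖]⟩

theorem isEnergyBounded_mom_pos : IsEnergyBounded (schwartzMom ∘ₗ schwartzPos) := by
  refine ⟨2, fun φ => ?_⟩
  refine le_of_sq_le_sq ?_ (by positivity)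
  have := isCanonicalPair_schwartz.second_order_le φ
  change ‖schwartzToL2 (schwartzMom (schwartzPos φ))‖ ^ 2 ≤ _
  rw [isCanonicalPair_schwartz.norm_sq_eq, schwartzEnergy_apply]
  nlinarith [sq_nonneg ‖schwartzToL2 (schwartzMom (schwartzMom φ))‖,
    sq_nonneg ‖schwartzToL2 (schwartzPos (schwartzPos φ))‖]

/-- `(P² + Q²)⁻¹` on `L²(ℝ)`. -/
noncomputable def invEnergy : L2R →L[ℂ] L2R := mulInvEnergy LinearMap.id

/-- `P² (P² + Q²)⁻¹` on `L²(ℝ)`. -/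
noncomputable def momMomInv : L2R →L[ℂ] L2R := mulInvEnergy (schwartzMom ∘ₗ schwartzMom)

/-- `Q² (P² + Q²)⁻¹` on `L²(ℝ)`. -/
noncomputable def posPosInv : L2R →L[ℂ] L2R := mulInvEnergy (schwartzPos ∘ₗ schwartzPos)

/-- `P Q (P² + Q²)⁻¹` on `L²(ℝ)`. -/
noncomputable def momPosInv : L2R →L[ℂ] L2R := mulInvEnergy (schwartzMom ∘ₗ schwartzPos)

/-- `Q P (P² + Q²)⁻¹` on `L²(ℝ)`. -/
noncomputable def posMomInv : L2R →L[ℂ] L2R := mulInvEnergy (schwartzPos ∘ₗ schwartzMom)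

theorem invEnergy_schwartzEnergy (φ : 𝓢(ℝ, ℂ)) :
    invEnergy (schwartzEnergy φ) = schwartzToL2 φ :=
  mulInvEnergy_schwartzEnergy isEnergyBounded_id φ

theorem momMomInv_schwartzEnergy (φ : 𝓢(ℝ, ℂ)) :
    momMomInv (schwartzEnergy φ) = schwartzToL2 (schwartzMom (schwartzMom φ)) :=
  mulInvEnergy_schwartzEnergy isEnergyBounded_mom_mom φ

theorem posPosInv_schwartzEnergy (φ : 𝓢(ℝ, ℂ)) :
    posPosInv (schwartzEnergy φ) = schwartzToL2 (schwartzPos (schwartzPos φ)) :=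
  mulInvEnergy_schwartzEnergy isEnergyBounded_pos_pos φ

theorem momPosInv_schwartzEnergy (φ : 𝓢(ℝ, ℂ)) :
    momPosInv (schwartzEnergy φ) = schwartzToL2 (schwartzMom (schwartzPos φ)) :=
  mulInvEnergy_schwartzEnergy isEnergyBounded_mom_pos φ

theorem posMomInv_schwartzEnergy (φ : 𝓢(ℝ, ℂ)) :
    posMomInv (schwartzEnergy φ) = schwartzToL2 (schwartzPos (schwartzMom φ)) :=
  mulInvEnergy_schwartzEnergy isEnergyBounded_pos_mom φ

/-- Membership in the graph is a family of pairings against Schwartz functions, hence a closed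
condition on f; it is enough to check it on the dense range of P² + Q². -/
theorem mulInvEnergy_mem_graph_momOp {Z : 𝓢(ℝ, ℂ) →ₗ[ℂ] 𝓢(ℝ, ℂ)} (hZ : IsEnergyBounded Z)
    (hZ' : IsEnergyBounded (schwartzMom ∘ₗ Z)) (f : L2R) :
    (mulInvEnergy Z f, mulInvEnergy (schwartzMom ∘ₗ Z) f) ∈ momOp.graph := by
  rw [mem_graph_momOp_iff_inner]
  intro φ
  refine denseRange_schwartzEnergy.induction_on f (isClosed_eq (by fun_prop) (by fun_prop))
    fun ψ => ?_
  rw [mulInvEnergy_schwartzEnergy hZ, mulInvEnergy_schwartzEnergy hZ',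
    isCanonicalPair_schwartz.symm_left]
  rfl

theorem mulInvEnergy_mem_graph_posOp {Z : 𝓢(ℝ, ℂ) →ₗ[ℂ] 𝓢(ℝ, ℂ)} (hZ : IsEnergyBounded Z)
    (hZ' : IsEnergyBounded (schwartzPos ∘ₗ Z)) (f : L2R) :
    (mulInvEnergy Z f, mulInvEnergy (schwartzPos ∘ₗ Z) f) ∈ posOp.graph := by
  rw [mem_graph_posOp_iff_inner]
  intro φ
  refine denseRange_schwartzEnergy.induction_on f (isClosed_eq (by fun_prop) (by fun_prop))
    fun ψ => ?_
  rw [mulInvEnergy_schwartzEnergy hZ, mulInvEnergy_schwartzEnergy hZ',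
    isCanonicalPair_schwartz.symm_right]
  rfl

theorem momPosInv_eq (f : L2R) : momPosInv f = posMomInv f - Complex.I • invEnergy f := by
  refine denseRange_schwartzEnergy.induction_on f (isClosed_eq (by fun_prop) (by fun_prop))
    fun φ => ?_
  rw [momPosInv_schwartzEnergy, posMomInv_schwartzEnergy, invEnergy_schwartzEnergy,
    isCanonicalPair_schwartz.comm, map_sub, map_smul]

theorem inner_schwartzEnergy_of_graph {u a b p q : L2R} (ha : (u, a) ∈ momOp.graph)
    (hp : (a, p) ∈ momOp.graph) (hb : (u, b) ∈ posOp.graph) (hq : (b, q) ∈ posOp.graph)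
    (φ : 𝓢(ℝ, ℂ)) : inner ℂ (schwartzEnergy φ) u = inner ℂ (schwartzToL2 φ) (p + q) := by
  rw [mem_graph_momOp_iff_inner] at ha hp
  rw [mem_graph_posOp_iff_inner] at hb hq
  rw [schwartzEnergy_apply, map_add, inner_add_left, ha, hp, hb, hq, inner_add_right]

theorem inner_schwartzEnergy_invEnergy (φ : 𝓢(ℝ, ℂ)) (f : L2R) :
    inner ℂ (schwartzEnergy φ) (invEnergy f) = inner ℂ (schwartzToL2 φ) f := by
  refine denseRange_schwartzEnergy.induction_on f (isClosed_eq (by fun_prop) (by fun_prop))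
    fun ψ => ?_
  have h := isCanonicalPair_schwartz
  rw [invEnergy_schwartzEnergy, schwartzEnergy_apply, schwartzEnergy_apply, map_add, map_add,
    inner_add_left, inner_add_right, h.symm_left, h.symm_left, h.symm_right, h.symm_right]

/-- The range of `invEnergy` is the domain of the number operator. -/
theorem eq_invEnergy_of_graph {u a b p q : L2R} (ha : (u, a) ∈ momOp.graph)
    (hp : (a, p) ∈ momOp.graph) (hb : (u, b) ∈ posOp.graph) (hq : (b, q) ∈ posOp.graph) :
    invEnergy (p + q) = u := by
  -- Both vectors pair equally with the dense range of P² + Q². This is uniqueness in the weak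
  -- sense, so Dom N contains nothing beyond the range of `invEnergy`.
  rw [← sub_eq_zero]
  refine eq_zero_of_inner_schwartzEnergy fun φ => ?_
  rw [inner_sub_right, inner_schwartzEnergy_of_graph ha hp hb hq, inner_schwartzEnergy_invEnergy,
    sub_self]

theorem denseRange_invEnergy : DenseRange invEnergy := by
  refine denseRange_schwartzToL2.mono ?_
  rintro _ ⟨φ, rfl⟩
  exact ⟨schwartzEnergy φ, invEnergy_schwartzEnergy φ⟩

theorem norm_invEnergy_sq_le (f : L2R) :
    ‖invEnergy f‖ ^ 2 ≤ (inner ℂ f (invEnergy f)).re := by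
  refine denseRange_schwartzEnergy.induction_on f (isClosed_le (by fun_prop) (by fun_prop))
    fun φ => ?_
  rw [invEnergy_schwartzEnergy, schwartzEnergy_apply, isCanonicalPair_schwartz.inner_energy]
  exact isCanonicalPair_schwartz.norm_sq_le_energy φ

theorem inner_invEnergy_im (f : L2R) : (inner ℂ f (invEnergy f)).im = 0 := by
  refine denseRange_schwartzEnergy.induction_on f (isClosed_eq (by fun_prop) (by fun_prop))
    fun φ => ?_
  rw [invEnergy_schwartzEnergy, schwartzEnergy_apply, isCanonicalPair_schwartz.inner_energy,
    Complex.ofReal_im]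

theorem norm_posPosInv_le (f : L2R) : ‖posPosInv f‖ ≤ 2 * ‖f‖ := by
  refine denseRange_schwartzEnergy.induction_on f (isClosed_le (by fun_prop) (by fun_prop))
    fun φ => ?_
  rw [posPosInv_schwartzEnergy]
  refine le_of_sq_le_sq ?_ (by positivity)
  have := isCanonicalPair_schwartz.second_order_le φ
  rw [schwartzEnergy_apply]
  nlinarith [sq_nonneg ‖schwartzToL2 (schwartzMom (schwartzMom φ))‖,
    sq_nonneg ‖schwartzToL2 (schwartzPos (schwartzMom φ))‖]

/-- The operator `(a P² + b Q² + c (P Q + Q P)) (P² + Q²)⁻¹` on `L²(ℝ)`. -/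
noncomputable def quadraticInv (a b c : ℂ) : L2R →L[ℂ] L2R :=
  a • momMomInv + b • posPosInv + c • (momPosInv + posMomInv)

theorem quadraticInv_apply (a b c : ℂ) (f : L2R) : quadraticInv a b c f
    = a • momMomInv f + b • posPosInv f + c • (momPosInv f + posMomInv f) := rfl

theorem quadraticInv_schwartzEnergy (a b c : ℂ) (φ : 𝓢(ℝ, ℂ)) :
    quadraticInv a b c (schwartzEnergy φ)
      = schwartzToL2 (a • schwartzMom (schwartzMom φ) + b • schwartzPos (schwartzPos φ)
        + c • (schwartzMom (schwartzPos φ) + schwartzPos (schwartzMom φ))) := by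
  rw [quadraticInv_apply, momMomInv_schwartzEnergy, posPosInv_schwartzEnergy,
    momPosInv_schwartzEnergy, posMomInv_schwartzEnergy]
  simp only [map_add, map_smul]

theorem quadraticInv_elliptic {a b c : ℂ} {e : ℝ}
    (he : 0 ≤ e) (ha : e ≤ a.re) (hb : e ≤ b.re) (hc : c.re ^ 2 ≤ (a.re - e) * (b.re - e))
    (f : L2R) :
    e / 2 * ‖f‖ ^ 2 - (a.re + b.re + |a.im - b.im| + 2 * |c.im|) * (inner ℂ f (invEnergy f)).re
      ≤ (inner ℂ f (quadraticInv a b c f)).re := by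
  refine denseRange_schwartzEnergy.induction_on f (isClosed_le (by fun_prop) (by fun_prop))
    fun φ => ?_
  have h := isCanonicalPair_schwartz.elliptic he ha hb hc φ
  rw [invEnergy_schwartzEnergy, quadraticInv_schwartzEnergy]
  rw [schwartzEnergy_apply, isCanonicalPair_schwartz.inner_energy, Complex.ofReal_re]
  exact h

/-- By the commutator, ‖u‖² = -2 Im⟨P u, Q u⟩, so subtracting t ‖u‖² amounts to replacing the
off-diagonal entry c.re by c.re - i t. The hypothesis is nonnegativity of the resulting determinant.
-/
theorem quadraticInv_accretive {a b c : ℂ} {t : ℝ} (ha : 0 ≤ a.re) (hb : 0 ≤ b.re)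
    (hc : c.re ^ 2 + t ^ 2 ≤ a.re * b.re) (f : L2R) :
    t * ‖invEnergy f‖ ^ 2 ≤ (inner ℂ (invEnergy f) (quadraticInv a b c f)).re := by
  refine denseRange_schwartzEnergy.induction_on f (isClosed_le (by fun_prop) (by fun_prop))
    fun φ => ?_
  have h := isCanonicalPair_schwartz
  rw [invEnergy_schwartzEnergy, quadraticInv_schwartzEnergy, h.inner_quadratic_re]
  have hn : ‖(⟨c.re, -t⟩ : ℂ)‖ ^ 2 ≤ a.re * b.re := by
    rw [Complex.sq_norm, Complex.normSq_mk]
    linarith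
  have hq := quadratic_form_nonneg ha hb hn (schwartzToL2 (schwartzMom φ))
    (schwartzToL2 (schwartzPos φ))
  have hi := h.inner_self_im φ
  rw [inner_im_comm] at hi
  rw [Complex.mul_re] at hq
  have e : ‖schwartzToL2 φ‖ ^ 2 = -2 * (inner ℂ (schwartzToL2 (schwartzMom φ))
      (schwartzToL2 (schwartzPos φ))).im := by linarith
  rw [e]
  linarith

end Extension

end QFP

namespace QFP

/-! ### Calculus of graphs of partially defined operators -/

section Graphs

theorem mem_graph_add {A B : L2R →ₗ.[ℂ] L2R} {u a b : L2R} (ha : (u, a) ∈ A.graph)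
    (hb : (u, b) ∈ B.graph) : (u, a + b) ∈ (A + B).graph := by
  rw [LinearPMap.mem_graph_iff] at ha hb ⊢
  obtain ⟨x, rfl, hx⟩ := ha
  obtain ⟨y, hy, hy'⟩ := hb
  dsimp only at hx hy hy'
  refine ⟨⟨x, x.2, by rw [← hy]; exact y.2⟩, rfl, ?_⟩
  rw [← hx, ← hy', LinearPMap.add_apply]
  congr 2
  exact Subtype.ext hy.symm

theorem mem_graph_sub {A B : L2R →ₗ.[ℂ] L2R} {u a b : L2R} (ha : (u, a) ∈ A.graph)
    (hb : (u, b) ∈ B.graph) : (u, a - b) ∈ (A - B).graph := by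
  rw [LinearPMap.mem_graph_iff] at ha hb ⊢
  obtain ⟨x, rfl, hx⟩ := ha
  obtain ⟨y, hy, hy'⟩ := hb
  dsimp only at hx hy hy'
  refine ⟨⟨x, x.2, by rw [← hy]; exact y.2⟩, rfl, ?_⟩
  rw [← hx, ← hy', LinearPMap.sub_apply]
  congr 2
  exact Subtype.ext hy.symm

theorem mem_graph_smul (c : ℂ) {A : L2R →ₗ.[ℂ] L2R} {u a : L2R} (ha : (u, a) ∈ A.graph) :
    (u, c • a) ∈ (c • A).graph := by
  rw [LinearPMap.mem_graph_iff] at ha ⊢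
  obtain ⟨x, rfl, hx⟩ := ha
  exact ⟨x, rfl, congrArg (c • ·) hx⟩

theorem mem_graph_idOp (u : L2R) : (u, u) ∈ idOp.graph := by
  rw [LinearPMap.mem_graph_iff]
  exact ⟨⟨u, trivial⟩, rfl, rfl⟩

theorem mem_graph_domRestrict {A : L2R →ₗ.[ℂ] L2R} {D : Submodule ℂ L2R} {u a : L2R}
    (ha : (u, a) ∈ A.graph) (hu : u ∈ D) : (u, a) ∈ (A.domRestrict D).graph := by
  rw [LinearPMap.mem_graph_iff] at ha ⊢
  obtain ⟨x, rfl, hx⟩ := ha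
  exact ⟨⟨x, hu, x.2⟩, rfl, hx⟩

theorem mem_graph_opComp {A B : L2R →ₗ.[ℂ] L2R} {u v w : L2R} (hv : (u, v) ∈ B.graph)
    (hw : (v, w) ∈ A.graph) : (u, w) ∈ (opComp A B).graph := by
  rw [LinearPMap.mem_graph_iff] at hv hw ⊢
  obtain ⟨x, rfl, hx⟩ := hv
  obtain ⟨y, hy, rfl⟩ := hw
  dsimp only at hx hy
  have hy2 : B x ∈ A.domain := by rw [hx, ← hy]; exact y.2
  refine ⟨⟨x, ⟨x, hy2, rfl⟩⟩, rfl, ?_⟩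
  change A ⟨B x, _⟩ = A y
  congr 1
  exact Subtype.ext (hx.trans hy.symm)

theorem exists_of_mem_opComp_domain {A B : L2R →ₗ.[ℂ] L2R} {u : L2R}
    (hu : u ∈ (opComp A B).domain) : ∃ v w, (u, v) ∈ B.graph ∧ (v, w) ∈ A.graph := by
  obtain ⟨x, hx, rfl⟩ := hu
  exact ⟨B x, A ⟨B x, hx⟩, B.mem_graph x, A.mem_graph ⟨B x, hx⟩⟩

theorem mem_graph_adjoint {T : L2R →ₗ.[ℂ] L2R} (hT : Dense (T.domain : Set L2R)) {v w : L2R}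
    (h : ∀ x y, (x, y) ∈ T.graph → inner ℂ w x = inner ℂ v y) : (v, w) ∈ T.adjoint.graph := by
  have h' : ∀ x : T.domain, inner ℂ w (x : L2R) = inner ℂ v (T x) := fun x =>
    h x (T x) (T.mem_graph x)
  rw [LinearPMap.mem_graph_iff]
  exact ⟨⟨v, LinearPMap.mem_adjoint_domain_of_exists v ⟨w, h'⟩⟩, rfl,
    LinearPMap.adjoint_apply_eq hT _ h'⟩

end Graphs

/-! ### The domain of the number operator -/

section NumberDomain

theorem invEnergy_mem_graph_momOp (f : L2R) :
    (invEnergy f, mulInvEnergy schwartzMom f) ∈ momOp.graph :=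
  mulInvEnergy_mem_graph_momOp isEnergyBounded_id isEnergyBounded_mom f

theorem invEnergy_mem_graph_posOp (f : L2R) :
    (invEnergy f, mulInvEnergy schwartzPos f) ∈ posOp.graph :=
  mulInvEnergy_mem_graph_posOp isEnergyBounded_id isEnergyBounded_pos f

theorem mem_graph_mom_mom (f : L2R) : (invEnergy f, momMomInv f) ∈ (opComp momOp momOp).graph :=
  mem_graph_opComp (invEnergy_mem_graph_momOp f)
    (mulInvEnergy_mem_graph_momOp isEnergyBounded_mom isEnergyBounded_mom_mom f)

theorem mem_graph_pos_pos (f : L2R) : (invEnergy f, posPosInv f) ∈ (opComp posOp posOp).graph :=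
  mem_graph_opComp (invEnergy_mem_graph_posOp f)
    (mulInvEnergy_mem_graph_posOp isEnergyBounded_pos isEnergyBounded_pos_pos f)

theorem mem_graph_mom_pos (f : L2R) : (invEnergy f, momPosInv f) ∈ (opComp momOp posOp).graph :=
  mem_graph_opComp (invEnergy_mem_graph_posOp f)
    (mulInvEnergy_mem_graph_momOp isEnergyBounded_pos isEnergyBounded_mom_pos f)

theorem mem_graph_pos_mom (f : L2R) : (invEnergy f, posMomInv f) ∈ (opComp posOp momOp).graph :=
  mem_graph_opComp (invEnergy_mem_graph_momOp f)
    (mulInvEnergy_mem_graph_posOp isEnergyBounded_mom isEnergyBounded_pos_mom f)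

theorem mem_numberOp_domain_iff (u : L2R) :
    u ∈ numberOp.domain ↔ ∃ f, invEnergy f = u := by
  constructor
  · rintro ⟨⟨hp, hq⟩, -⟩
    obtain ⟨a, p, ha, hp⟩ := exists_of_mem_opComp_domain hp
    obtain ⟨b, q, hb, hq⟩ := exists_of_mem_opComp_domain hq
    exact ⟨p + q, eq_invEnergy_of_graph ha hp hb hq⟩
  · rintro ⟨f, rfl⟩
    exact LinearPMap.mem_domain_of_mem_graph (mem_graph_smul (1 / 2 : ℂ)
      (mem_graph_sub (mem_graph_add (mem_graph_mom_mom f) (mem_graph_pos_pos f))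
        (mem_graph_idOp _)))

/-- An operator on a subspace of `Dom N` that contains `{(R f, G f)}` has exactly this graph. -/
theorem mem_graph_iff_of_domain_le {A : L2R →ₗ.[ℂ] L2R} {G : L2R →L[ℂ] L2R}
    (hA : A.domain ≤ numberOp.domain) (hG : ∀ f, (invEnergy f, G f) ∈ A.graph) (u v : L2R) :
    (u, v) ∈ A.graph ↔ ∃ f, invEnergy f = u ∧ G f = v := by
  constructor
  · intro h
    obtain ⟨f, rfl⟩ := (mem_numberOp_domain_iff u).1 (hA (LinearPMap.mem_domain_of_mem_graph h))
    exact ⟨f, rfl, LinearPMap.mem_graph_snd_inj A (hG f) h rfl⟩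
  · rintro ⟨f, rfl, rfl⟩
    exact hG f

end NumberDomain

/-! ### Relative boundedness of the potential -/

section Potential

theorem posPosInv_ae_eq (f : L2R) :
    ∀ᵐ x : ℝ, posPosInv f x = (x : ℂ) * ((x : ℂ) * invEnergy f x) := by
  have h1 := (mem_graph_mulOp _ _ _).1 (invEnergy_mem_graph_posOp f)
  have h2 := (mem_graph_mulOp _ _ _).1
    (mulInvEnergy_mem_graph_posOp isEnergyBounded_pos isEnergyBounded_pos_pos f)
  filter_upwards [h1, h2] with x h1 h2
  rw [← h1]
  exact h2

theorem ae_norm_mul_invEnergy_le {V : ℝ → ℝ} {a b : ℝ} (hb : 0 ≤ b)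
    (ha : 0 ≤ a) (hV : ∀ x, |V x| ≤ a * x ^ 2 + b) (f : L2R) :
    ∀ᵐ x : ℝ, ‖(V x : ℂ) * invEnergy f x‖
      ≤ ‖((a : ℂ) • posPosInv f + (b : ℂ) • invEnergy f : L2R) x‖ := by
  filter_upwards [posPosInv_ae_eq f, Lp.coeFn_add ((a : ℂ) • posPosInv f) ((b : ℂ) • invEnergy f),
    Lp.coeFn_smul (a : ℂ) (posPosInv f), Lp.coeFn_smul (b : ℂ) (invEnergy f)] with x h1 h2 h3 h4
  rw [h2, Pi.add_apply, h3, h4, Pi.smul_apply, Pi.smul_apply, h1]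
  have e : (a : ℂ) • ((x : ℂ) * ((x : ℂ) * invEnergy f x)) + (b : ℂ) • invEnergy f x
      = ((a * x ^ 2 + b : ℝ) : ℂ) * invEnergy f x := by
    simp only [smul_eq_mul]
    push_cast
    ring
  rw [e, norm_mul, norm_mul, Complex.norm_real, Complex.norm_real, Real.norm_eq_abs,
    Real.norm_of_nonneg (by positivity)]
  gcongr
  exact hV x

theorem norm_le_of_mem_graph_mulOp {V : ℝ → ℝ} {a b : ℝ} (hb : 0 ≤ b)
    (ha : 0 ≤ a) (hV : ∀ x, |V x| ≤ a * x ^ 2 + b) {f g : L2R}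
    (hg : (invEnergy f, g) ∈ (mulOp V).graph) :
    ‖g‖ ≤ a * ‖posPosInv f‖ + b * ‖invEnergy f‖ := by
  have h1 : ‖g‖ ≤ ‖((a : ℂ) • posPosInv f + (b : ℂ) • invEnergy f : L2R)‖ := by
    refine Lp.norm_le_norm_of_ae_le ?_
    filter_upwards [(mem_graph_mulOp _ _ _).1 hg, ae_norm_mul_invEnergy_le hb ha hV f] with x h1 h2
    rw [h1]
    exact h2
  refine h1.trans ((norm_add_le _ _).trans_eq ?_)
  rw [norm_smul, norm_smul, Complex.norm_real, Complex.norm_real, Real.norm_of_nonneg ha,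
    Real.norm_of_nonneg hb]

theorem invEnergy_mem_mulOp_domain {V : ℝ → ℝ} (hc : Continuous V) {a b : ℝ} (hb : 0 ≤ b)
    (ha : 0 ≤ a) (hV : ∀ x, |V x| ≤ a * x ^ 2 + b) (f : L2R) :
    invEnergy f ∈ (mulOp V).domain := by
  have hm : MemLp (fun x : ℝ => (V x : ℂ) * invEnergy f x) 2 volume := by
    refine (Lp.memLp ((a : ℂ) • posPosInv f + (b : ℂ) • invEnergy f)).of_le ?_
      (ae_norm_mul_invEnergy_le hb ha hV f)
    exact ((Complex.continuous_ofReal.comp hc).aestronglyMeasurable).mul (Lp.memLp _).1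
  refine LinearPMap.mem_domain_of_mem_graph (y := hm.toLp) ?_
  rw [mem_graph_mulOp]
  exact hm.coeFn_toLp

/-- A potential of at most quadratic growth is bounded relative to `P² + Q²`. -/
theorem exists_mulOp_invEnergy {V : ℝ → ℝ} (hc : Continuous V) {a b : ℝ} (hb : 0 ≤ b)
    (ha : 0 ≤ a) (hV : ∀ x, |V x| ≤ a * x ^ 2 + b) :
    ∃ W : L2R →L[ℂ] L2R, ∀ f, (invEnergy f, W f) ∈ (mulOp V).graph := by
  let W₀ : L2R →ₗ[ℂ] L2R := (mulOp V).toFun ∘ₗ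
    invEnergy.toLinearMap.codRestrict (mulOp V).domain (invEnergy_mem_mulOp_domain hc hb ha hV)
  have hW : ∀ f, (invEnergy f, W₀ f) ∈ (mulOp V).graph := fun f =>
    (mulOp V).mem_graph ⟨invEnergy f, invEnergy_mem_mulOp_domain hc hb ha hV f⟩
  refine ⟨W₀.mkContinuous (a * ‖posPosInv‖ + b * ‖invEnergy‖) fun f => ?_, hW⟩
  refine (norm_le_of_mem_graph_mulOp hb ha hV (hW f)).trans ?_
  rw [add_mul, mul_assoc, mul_assoc]
  gcongr <;> exact ContinuousLinearMap.le_opNorm _ _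

theorem inner_im_of_mem_graph_mulOp {V : ℝ → ℝ} {u g : L2R} (hg : (u, g) ∈ (mulOp V).graph) :
    (inner ℂ u g).im = 0 := by
  rw [L2.inner_def]
  have e : ∫ x, inner ℂ (u x) (g x) = ∫ x, ((V x * ‖u x‖ ^ 2 : ℝ) : ℂ) := by
    refine integral_congr_ae ?_
    filter_upwards [(mem_graph_mulOp _ _ _).1 hg] with x hx
    rw [hx, ← smul_eq_mul, inner_smul_right, inner_self_eq_norm_sq_to_K]
    push_cast
    rfl
  rw [e, integral_complex_ofReal, Complex.ofReal_im]

/-- Since s - 1/2 < 0, y ^ (s - 1/2) ≤ δ beyond some T; below T the power is bounded by its value at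
T. -/
theorem exists_rpow_le_sqrt_add {s δ : ℝ} (hs₀ : 0 ≤ s) (hs : s < 1 / 2) (hδ : 0 < δ) :
    ∃ K, 0 ≤ K ∧ ∀ y, 0 < y → y ^ s ≤ δ * √y + K := by
  have h := tendsto_rpow_neg_atTop (show 0 < 1 / 2 - s by linarith)
  obtain ⟨T, hT⟩ := (h.eventually (ge_mem_nhds hδ)).exists_forall_of_atTop
  refine ⟨(max T 0) ^ s, by positivity, fun y hy => ?_⟩
  rcases le_total T y with h1 | h1
  · have e : y ^ s = y ^ (-(1 / 2 - s)) * √y := by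
      rw [Real.sqrt_eq_rpow, ← Real.rpow_add hy]
      congr 1
      ring
    have h2 : y ^ s ≤ δ * √y := by
      rw [e]
      gcongr
      exact hT y h1
    have : 0 ≤ (max T 0) ^ s := by positivity
    linarith
  · have h2 : y ^ s ≤ (max T 0) ^ s :=
      Real.rpow_le_rpow hy.le (h1.trans (le_max_left _ _)) hs₀
    have : 0 ≤ δ * √y := by positivity
    linarith

/-- A potential with derivative of sublinear growth is `o(x²)` at infinity. -/
theorem exists_potential_le {V : ℝ → ℝ} {gV α : ℝ} (hV : Differentiable ℝ V)
    (hgV : 0 < gV) (hα₀ : 0 ≤ α) (hα₁ : α < 1)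
    (hgrowth : ∀ x : ℝ, |deriv V x| ≤ gV * (1 + |x| ^ 2) ^ (α / 2)) {ε : ℝ} (hε : 0 < ε) :
    ∃ C, 0 ≤ C ∧ ∀ x, |V x| ≤ ε * x ^ 2 + C := by
  obtain ⟨K, hK, hKy⟩ := exists_rpow_le_sqrt_add (s := α / 2) (by positivity) (by linarith)
    (show 0 < ε / (2 * gV) by positivity)
  -- With r² = 1 + x², the mean value bound is at most (ε / 2) r² + gV K r. Completing the square
  -- turns the linear term into another (ε / 2) r² plus the last constant, and ε is what ε r²
  -- exceeds ε x² by.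
  refine ⟨|V 0| + ε + (gV * K) ^ 2 / (2 * ε), by positivity, fun x => ?_⟩
  have hd : |V x - V 0| ≤ gV * (1 + |x| ^ 2) ^ (α / 2) * |x| := by
    have h := (convex_Icc (-|x|) |x|).norm_image_sub_le_of_norm_deriv_le
      (f := V) (C := gV * (1 + |x| ^ 2) ^ (α / 2)) (x := 0) (y := x)
      (fun y _ => hV y) (fun y hy => ?_) ⟨by simp, abs_nonneg x⟩ ⟨neg_abs_le x, le_abs_self x⟩
    · simpa using h
    · refine (hgrowth y).trans ?_
      have : |y| ≤ |x| := abs_le.2 hy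
      gcongr
  set r := √(1 + |x| ^ 2) with hr
  have hr0 : 0 ≤ r := Real.sqrt_nonneg _
  have hr2 : r ^ 2 = 1 + x ^ 2 := by rw [hr, Real.sq_sqrt (by positivity), sq_abs]
  have hxr : |x| ≤ r := by
    rw [hr]
    exact Real.le_sqrt_of_sq_le (by linarith)
  have h1 := hKy (1 + |x| ^ 2) (by positivity)
  rw [← hr] at h1
  have h2 : gV * (1 + |x| ^ 2) ^ (α / 2) * |x| ≤ gV * (ε / (2 * gV) * r + K) * r := by gcongr
  have h3 : gV * (ε / (2 * gV) * r + K) * r = ε / 2 * r ^ 2 + gV * K * r := by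
    field_simp
  have h4 : gV * K * r ≤ ε / 2 * r ^ 2 + (gV * K) ^ 2 / (2 * ε) := by
    have h5 : ε / 2 * r ^ 2 + (gV * K) ^ 2 / (2 * ε) - gV * K * r
        = (ε * r - gV * K) ^ 2 / (2 * ε) := by
      field_simp
      ring
    have : 0 ≤ (ε * r - gV * K) ^ 2 / (2 * ε) := by positivity
    linarith
  have h6 : |V x| ≤ |V 0| + |V x - V 0| := by
    have := abs_add_le (V 0) (V x - V 0)
    rwa [add_sub_cancel] at this
  rw [hr2] at h3 h4
  nlinarith

end Potential

end QFP

namespace QFP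

/-! ### The operator G: Lindblad form, dissipativity and range condition -/

section Generator

variable {ω Dpp Dpq Dqq γ : ℝ}

/-- The bounded operator `G (P² + Q²)⁻¹`, where `W` stands for `V(q) (P² + Q²)⁻¹`. -/
noncomputable def opGInv (ω Dpp Dpq Dqq γ : ℝ) (W : L2R →L[ℂ] L2R) : L2R →L[ℂ] L2R :=
  (-((Dqq : ℂ) + Complex.I / 2)) • momMomInv
    - ((Dpp : ℂ) + Complex.I * (ω : ℂ) ^ 2 / 2) • posPosInv
    + ((Dpq : ℂ) - Complex.I * (γ : ℂ) / 2) • (momPosInv + posMomInv)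
    + ((γ : ℂ) / 2) • invEnergy
    - Complex.I • W

theorem opGInv_apply (W : L2R →L[ℂ] L2R) (f : L2R) : opGInv ω Dpp Dpq Dqq γ W f =
  (-((Dqq : ℂ) + Complex.I / 2)) • momMomInv f
    - ((Dpp : ℂ) + Complex.I * (ω : ℂ) ^ 2 / 2) • posPosInv f
    + ((Dpq : ℂ) - Complex.I * (γ : ℂ) / 2) • (momPosInv f + posMomInv f)
    + ((γ : ℂ) / 2) • invEnergy f
    - Complex.I • W f := rfl

theorem invEnergy_mem_graph_opG {V : ℝ → ℝ} {W : L2R →L[ℂ] L2R}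
    (hW : ∀ f, (invEnergy f, W f) ∈ (mulOp V).graph) (f : L2R) :
    (invEnergy f, opGInv ω Dpp Dpq Dqq γ W f) ∈ (opG ω Dpp Dpq Dqq γ V).graph := by
  refine mem_graph_domRestrict ?_ ((mem_numberOp_domain_iff _).2 ⟨f, rfl⟩)
  exact mem_graph_sub (mem_graph_add (mem_graph_add (mem_graph_sub
    (mem_graph_smul _ (mem_graph_mom_mom f)) (mem_graph_smul _ (mem_graph_pos_pos f)))
    (mem_graph_smul _ (mem_graph_add (mem_graph_mom_pos f) (mem_graph_pos_mom f))))
    (mem_graph_smul _ (mem_graph_idOp _))) (mem_graph_smul _ (hW f))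

theorem opG_domain_le (V : ℝ → ℝ) : (opG ω Dpp Dpq Dqq γ V).domain ≤ numberOp.domain :=
  inf_le_left

theorem schwartz_mem_graph_momOp (φ : 𝓢(ℝ, ℂ)) :
    (schwartzToL2 φ, schwartzToL2 (schwartzMom φ)) ∈ momOp.graph :=
  (mem_graph_momOp_iff_inner _ _).2 fun ψ => isCanonicalPair_schwartz.symm_left ψ φ

theorem schwartz_mem_graph_posOp (φ : 𝓢(ℝ, ℂ)) :
    (schwartzToL2 φ, schwartzToL2 (schwartzPos φ)) ∈ posOp.graph :=
  (mem_graph_posOp_iff_inner _ _).2 fun ψ => isCanonicalPair_schwartz.symm_right ψ φ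

/-- Symmetry of p against its whole maximal domain, as needed to evaluate the adjoints of
`lindblad₁` and `lindblad₂`; it passes from Schwartz functions by density. -/
theorem inner_mulInvEnergy_mom {Z : 𝓢(ℝ, ℂ) →ₗ[ℂ] 𝓢(ℝ, ℂ)} (hZ : IsEnergyBounded Z)
    (hZ' : IsEnergyBounded (schwartzMom ∘ₗ Z)) {x y : L2R} (h : (x, y) ∈ momOp.graph) (f : L2R) :
    inner ℂ (mulInvEnergy Z f) y = inner ℂ (mulInvEnergy (schwartzMom ∘ₗ Z) f) x := by
  rw [mem_graph_momOp_iff_inner] at h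
  refine denseRange_schwartzEnergy.induction_on f (isClosed_eq (by fun_prop) (by fun_prop))
    fun φ => ?_
  rw [mulInvEnergy_schwartzEnergy hZ, mulInvEnergy_schwartzEnergy hZ', ← h]
  rfl

theorem inner_mulInvEnergy_pos {Z : 𝓢(ℝ, ℂ) →ₗ[ℂ] 𝓢(ℝ, ℂ)} (hZ : IsEnergyBounded Z)
    (hZ' : IsEnergyBounded (schwartzPos ∘ₗ Z)) {x y : L2R} (h : (x, y) ∈ posOp.graph) (f : L2R) :
    inner ℂ (mulInvEnergy Z f) y = inner ℂ (mulInvEnergy (schwartzPos ∘ₗ Z) f) x := by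
  rw [mem_graph_posOp_iff_inner] at h
  refine denseRange_schwartzEnergy.induction_on f (isClosed_eq (by fun_prop) (by fun_prop))
    fun φ => ?_
  rw [mulInvEnergy_schwartzEnergy hZ, mulInvEnergy_schwartzEnergy hZ', ← h]
  rfl

theorem mem_graph_adjoint_comp_linear (c d : ℂ) (f : L2R) :
    (invEnergy f, (starRingEnd ℂ) c • (c • momMomInv f + d • momPosInv f)
        + (starRingEnd ℂ) d • (c • posMomInv f + d • posPosInv f))
      ∈ (opComp (c • momOp + d • posOp).adjoint (c • momOp + d • posOp)).graph := by
  refine mem_graph_opComp (v := c • mulInvEnergy schwartzMom f + d • mulInvEnergy schwartzPos f)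
    (mem_graph_add (mem_graph_smul _ (invEnergy_mem_graph_momOp f))
      (mem_graph_smul _ (invEnergy_mem_graph_posOp f))) (mem_graph_adjoint ?_ ?_)
  · refine denseRange_schwartzToL2.mono ?_
    rintro _ ⟨φ, rfl⟩
    exact LinearPMap.mem_domain_of_mem_graph (mem_graph_add
      (mem_graph_smul c (schwartz_mem_graph_momOp φ)) (mem_graph_smul d (schwartz_mem_graph_posOp φ)))
  · intro x y hxy
    obtain ⟨hx1, hx2⟩ := LinearPMap.mem_domain_of_mem_graph hxy
    have h1 := momOp.mem_graph ⟨x, hx1⟩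
    have h2 := posOp.mem_graph ⟨x, hx2⟩
    have hy : y = c • momOp ⟨x, hx1⟩ + d • posOp ⟨x, hx2⟩ :=
      LinearPMap.mem_graph_snd_inj _ hxy
        (mem_graph_add (mem_graph_smul c h1) (mem_graph_smul d h2)) rfl
    rw [hy]
    simp only [inner_add_left, inner_add_right, inner_smul_left, inner_smul_right,
      inner_mulInvEnergy_mom isEnergyBounded_mom isEnergyBounded_mom_mom h1,
      inner_mulInvEnergy_mom isEnergyBounded_pos isEnergyBounded_mom_pos h1,
      inner_mulInvEnergy_pos isEnergyBounded_mom isEnergyBounded_pos_mom h2,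
      inner_mulInvEnergy_pos isEnergyBounded_pos isEnergyBounded_pos_pos h2,
      Complex.conj_conj, momMomInv, momPosInv, posMomInv, posPosInv]

theorem mem_graph_adjoint_comp_mom (c : ℂ) (f : L2R) :
    (invEnergy f, (starRingEnd ℂ) c • c • momMomInv f)
      ∈ (opComp (c • momOp).adjoint (c • momOp)).graph := by
  refine mem_graph_opComp (v := c • mulInvEnergy schwartzMom f)
    (mem_graph_smul _ (invEnergy_mem_graph_momOp f)) (mem_graph_adjoint ?_ ?_)
  · refine denseRange_schwartzToL2.mono ?_
    rintro _ ⟨φ, rfl⟩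
    exact LinearPMap.mem_domain_of_mem_graph (mem_graph_smul c (schwartz_mem_graph_momOp φ))
  · intro x y hxy
    have hx : x ∈ (c • momOp).domain := LinearPMap.mem_domain_of_mem_graph hxy
    have hx1 : x ∈ momOp.domain := hx
    have h1 := momOp.mem_graph ⟨x, hx1⟩
    have hy : y = c • momOp ⟨x, hx1⟩ :=
      LinearPMap.mem_graph_snd_inj _ hxy (mem_graph_smul c h1) rfl
    rw [hy]
    simp only [inner_smul_left, inner_smul_right,
      inner_mulInvEnergy_mom isEnergyBounded_mom isEnergyBounded_mom_mom h1,
      Complex.conj_conj, momMomInv]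

theorem mem_graph_congr {A : L2R →ₗ.[ℂ] L2R} {u a b : L2R} (h : (u, a) ∈ A.graph) (e : a = b) :
    (u, b) ∈ A.graph := e ▸ h

theorem invEnergy_mem_graph_lindbladG {V : ℝ → ℝ} {W : L2R →L[ℂ] L2R} (hDpp : 0 < Dpp)
    (hΔ : 0 ≤ lindbladDelta Dpp Dpq Dqq γ)
    (hW : ∀ f, (invEnergy f, W f) ∈ (mulOp V).graph) (f : L2R) :
    (invEnergy f, opGInv ω Dpp Dpq Dqq γ W f) ∈ (lindbladG ω Dpp Dpq Dqq γ V).graph := by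
  refine mem_graph_domRestrict ?_ ((mem_numberOp_domain_iff _).2 ⟨f, rfl⟩)
  have hH := mem_graph_add (mem_graph_smul (1 / 2 : ℂ) (mem_graph_add (mem_graph_add
    (mem_graph_mom_mom f) (mem_graph_smul ((ω : ℂ) ^ 2) (mem_graph_pos_pos f)))
    (mem_graph_smul (γ : ℂ) (mem_graph_add (mem_graph_mom_pos f) (mem_graph_pos_mom f))))) (hW f)
  set s : ℝ := √(2 * Dpp) with hs
  have hs0 : s ≠ 0 := (Real.sqrt_pos.2 (by linarith)).ne'
  have hs2 : s ^ 2 = 2 * Dpp := Real.sq_sqrt (by linarith)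
  have hd2 : √(lindbladDelta Dpp Dpq Dqq γ) ^ 2 = Dpp * Dqq - Dpq ^ 2 - γ ^ 2 / 4 :=
    Real.sq_sqrt hΔ
  set r : ℝ := √(lindbladDelta Dpp Dpq Dqq γ) with hr
  have h := mem_graph_sub (mem_graph_smul (-(1 / 2) : ℂ) (mem_graph_add
    (mem_graph_adjoint_comp_linear ((-2 * (Dpq : ℂ) + Complex.I * (γ : ℂ)) / (s : ℂ)) (s : ℂ) f)
    (mem_graph_adjoint_comp_mom ((2 * r / s : ℝ) : ℂ) f))) (mem_graph_smul Complex.I hH)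
  refine mem_graph_congr h ?_
  have hsC : (s : ℂ) ≠ 0 := by exact_mod_cast hs0
  have hs2C : (s : ℂ) ^ 2 = 2 * Dpp := by exact_mod_cast hs2
  have hd2C : (r : ℂ) ^ 2 = Dpp * Dqq - Dpq ^ 2 - γ ^ 2 / 4 := by exact_mod_cast hd2
  set c : ℂ := (-2 * (Dpq : ℂ) + Complex.I * (γ : ℂ)) / (s : ℂ) with hc
  have hcc : (starRingEnd ℂ) c = (-2 * (Dpq : ℂ) - Complex.I * (γ : ℂ)) / (s : ℂ) := by
    rw [hc]
    simp [map_ofNat]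
    ring
  have e1 : c * s = -2 * (Dpq : ℂ) + Complex.I * (γ : ℂ) := by
    rw [hc, div_mul_cancel₀ _ hsC]
  have e2 : (starRingEnd ℂ) c * s = -2 * (Dpq : ℂ) - Complex.I * (γ : ℂ) := by
    rw [hcc, div_mul_cancel₀ _ hsC]
  -- Here Δ enters: (4 D_pq² + γ² + 4 Δ) / (2 D_pp) = 2 D_qq, so L₂ supplies exactly the missing
  -- part of the p² coefficient.
  have e3 : (starRingEnd ℂ) c * c + ((2 * r / s : ℝ) : ℂ) * ((2 * r / s : ℝ) : ℂ) = 2 * Dqq := by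
    rw [hcc, hc]
    push_cast
    field_simp
    rw [hs2C]
    linear_combination 4 * hd2C - (γ : ℂ) ^ 2 * Complex.I_sq
  -- Writing P Q as Q P - i isolates the commutator in L₁* L₁, which produces the constant γ / 2.
  rw [opGInv_apply, momPosInv_eq, Complex.conj_ofReal, Complex.conj_ofReal]
  linear_combination (norm := module) (-(1 / 2 : ℂ) * e3) • momMomInv f
    + (-(1 / 2 : ℂ) * hs2C) • posPosInv f + (-(1 / 2 : ℂ) * e2 - (1 / 2 : ℂ) * e1) • posMomInv f
    + ((1 / 2 : ℂ) * Complex.I * e2) • invEnergy f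
    - ((γ : ℂ) / 2 * Complex.I_sq) • invEnergy f

/-- If D_pp D_qq > D_pq², the real part is already definite and μ = 0 works. Otherwise Δ ≥ 0 forces
γ = 0 and D_pp D_qq = D_pq², and with μ = 1 the Hamiltonian part contributes determinant at least ω²
/ 4. -/
theorem exists_elliptic_parameters (hω : 0 < ω) (hDpp : 0 ≤ Dpp) (hDqq : 0 ≤ Dqq)
    (hΔ : 0 ≤ lindbladDelta Dpp Dpq Dqq γ) :
    ∃ μ e : ℝ, |μ| ≤ 1 ∧ 0 < e ∧ e ≤ Dqq + μ / 2 ∧ e ≤ Dpp + μ * ω ^ 2 / 2 ∧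
      (-Dpq + μ * γ / 2) ^ 2 ≤ (Dqq + μ / 2 - e) * (Dpp + μ * ω ^ 2 / 2 - e) := by
  have key : ∀ a b c : ℝ, 0 ≤ a → 0 ≤ b → c ^ 2 < a * b →
      ∃ e, 0 < e ∧ e ≤ a ∧ e ≤ b ∧ c ^ 2 ≤ (a - e) * (b - e) := by
    intro a b c ha hb h
    have hab : 0 < a * b := lt_of_le_of_lt (sq_nonneg c) h
    have ha' : 0 < a := lt_of_le_of_ne ha (by rintro rfl; simp at hab)
    have hb' : 0 < b := lt_of_le_of_ne hb (by rintro rfl; simp at hab)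
    have hs : 0 < a + b := by positivity
    -- Determinant over trace: a lower bound for the smallest eigenvalue, for which the shifted
    -- determinant is e².
    refine ⟨(a * b - c ^ 2) / (a + b), div_pos (by linarith) hs, ?_, ?_, ?_⟩
    · rw [div_le_iff₀ hs]
      nlinarith [sq_nonneg c]
    · rw [div_le_iff₀ hs]
      nlinarith [sq_nonneg c]
    · have e : (a - (a * b - c ^ 2) / (a + b)) * (b - (a * b - c ^ 2) / (a + b))
          = c ^ 2 + ((a * b - c ^ 2) / (a + b)) ^ 2 := by
        field_simp
        ring
      rw [e]
      nlinarith [sq_nonneg ((a * b - c ^ 2) / (a + b))]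
  unfold lindbladDelta at hΔ
  rcases (sub_nonneg.1 (show 0 ≤ Dqq * Dpp - Dpq ^ 2 by nlinarith [sq_nonneg γ])).lt_or_eq with h | h
  · obtain ⟨e, h1, h2, h3, h4⟩ := key Dqq Dpp Dpq hDqq hDpp h
    exact ⟨0, e, by simp, h1, by simpa using h2, by simpa using h3, by simpa using h4⟩
  · have hγ : γ = 0 := by
      have : γ ^ 2 ≤ 0 := by nlinarith
      exact pow_eq_zero_iff two_ne_zero |>.1 (le_antisymm this (sq_nonneg γ))
    have hω2 : 0 < ω ^ 2 := by positivity
    obtain ⟨e, h1, h2, h3, h4⟩ := key (Dqq + 1 / 2) (Dpp + 1 * ω ^ 2 / 2) (-Dpq + 1 * γ / 2)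
      (by positivity) (by positivity) (by rw [hγ]; nlinarith [mul_nonneg hDqq hω2.le])
    exact ⟨1, e, by simp, h1, h2, h3, h4⟩

/-- Accretivity of the quadratic part with t = γ / 2 cancels the constant γ / 2 exactly; the
potential contributes a purely imaginary term. -/
theorem re_inner_opGInv_nonpos {V : ℝ → ℝ} {W : L2R →L[ℂ] L2R} (hDpp : 0 ≤ Dpp) (hDqq : 0 ≤ Dqq)
    (hΔ : 0 ≤ lindbladDelta Dpp Dpq Dqq γ)
    (hW : ∀ f, (invEnergy f, W f) ∈ (mulOp V).graph) (f : L2R) :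
    (inner ℂ (invEnergy f) (opGInv ω Dpp Dpq Dqq γ W f)).re ≤ 0 := by
  unfold lindbladDelta at hΔ
  have h := quadraticInv_accretive (a := Dqq + Complex.I / 2) (b := Dpp + Complex.I * ω ^ 2 / 2)
    (c := -(Dpq - Complex.I * γ / 2)) (t := γ / 2)
    (by simpa using hDqq) (by simpa [← Complex.ofReal_pow] using hDpp)
    (by simp [← Complex.ofReal_pow]; nlinarith) f
  have hi := inner_im_of_mem_graph_mulOp (hW f)
  have e : opGInv ω Dpp Dpq Dqq γ W f = -quadraticInv (Dqq + Complex.I / 2)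
      (Dpp + Complex.I * ω ^ 2 / 2) (-(Dpq - Complex.I * γ / 2)) f
      + ((γ / 2 : ℝ) : ℂ) • invEnergy f - Complex.I • W f := by
    rw [opGInv_apply, quadraticInv_apply]
    push_cast
    module
  rw [e, inner_sub_right, inner_add_right, inner_neg_right, inner_smul_right, inner_smul_right,
    inner_self_eq_norm_sq_to_K]
  have e2 : (((γ / 2 : ℝ) : ℂ) * (‖invEnergy f‖ : ℂ) ^ 2).re = γ / 2 * ‖invEnergy f‖ ^ 2 := by
    rw [← Complex.ofReal_pow, ← Complex.ofReal_mul, Complex.ofReal_re]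
  simp only [Complex.sub_re, Complex.add_re, Complex.neg_re, Complex.coe_algebraMap, e2,
    Complex.I_mul_re, hi]
  linarith

/-- Lax–Milgram: pairing with f rather than with R f makes the form coercive in the full norm of f,
after rotation by ζ. -/
theorem exists_isUnit_smul_invEnergy_sub {W : L2R →L[ℂ] L2R} (hω : 0 < ω) (hDpp : 0 ≤ Dpp)
    (hDqq : 0 ≤ Dqq) (hΔ : 0 ≤ lindbladDelta Dpp Dpq Dqq γ)
    (hW : ∀ ε > 0, ∃ C, 0 ≤ C ∧ ∀ f, ‖W f‖ ≤ ε * ‖f‖ + C * ‖invEnergy f‖) :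
    ∃ l₀ : ℝ, ∀ l : ℝ, l₀ ≤ l → IsUnit (l • invEnergy - opGInv ω Dpp Dpq Dqq γ W) := by
  obtain ⟨μ, e, hμ, he, h1, h2, h3⟩ := exists_elliptic_parameters hω hDpp hDqq hΔ
  obtain ⟨C, hC, hWC⟩ := hW (e / 16) (by positivity)
  set ζ : ℂ := 1 - μ * Complex.I with hζ
  set a : ℂ := ζ * (Dqq + Complex.I / 2) with ha
  set b : ℂ := ζ * (Dpp + Complex.I * ω ^ 2 / 2) with hb
  set c : ℂ := ζ * (-(Dpq - Complex.I * γ / 2)) with hc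
  have hζn : ‖ζ‖ ≤ 2 := by
    refine (norm_sub_le _ _).trans ?_
    rw [norm_one, norm_mul, Complex.norm_I, Complex.norm_real, Real.norm_eq_abs]
    linarith
  have hζ0 : 0 < ‖ζ‖ := by
    rw [norm_pos_iff]
    intro h0
    have := congrArg Complex.re h0
    simp [hζ] at this
  have hare : a.re = Dqq + μ / 2 := by
    simp [ha, hζ]; ring
  have hbre : b.re = Dpp + μ * ω ^ 2 / 2 := by
    simp [hb, hζ, ← Complex.ofReal_pow]; ring
  have hcre : c.re = -Dpq + μ * γ / 2 := by
    simp [hc, hζ]; ring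
  set K := a.re + b.re + |a.im - b.im| + 2 * |c.im| with hK
  have hK0 : 0 ≤ K := by
    have : 0 ≤ a.re := by rw [hare]; linarith
    have : 0 ≤ b.re := by rw [hbre]; linarith
    positivity
  -- The three summands absorb the zeroth order term of G, the commutator terms, and the lower order
  -- part of the potential, all measured by ⟨f, R f⟩ ≥ ‖R f‖².
  refine ⟨γ / 2 + K + 8 * C ^ 2 / e, fun l hl => ?_⟩
  refine ContinuousLinearMap.isUnit_of_forall_le_norm_inner_map _
    (c := ⟨e / 8, by positivity⟩) (by exact_mod_cast (by positivity : 0 < e / 8)) fun f => ?_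
  set T : L2R := (l • invEnergy - opGInv ω Dpp Dpq Dqq γ W) f with hT
  have hell := quadraticInv_elliptic (a := a) (b := b) (c := c) he.le (by rw [hare]; exact h1)
    (by rw [hbre]; exact h2) (by rw [hare, hbre, hcre]; exact h3) f
  rw [← hK] at hell
  have eT : ζ • T = quadraticInv a b c f + (ζ * ((l - γ / 2 : ℝ) : ℂ)) • invEnergy f
      + (ζ * Complex.I) • W f := by
    rw [hT]
    have : (l • invEnergy - opGInv ω Dpp Dpq Dqq γ W) f
        = (l : ℂ) • invEnergy f - opGInv ω Dpp Dpq Dqq γ W f := rfl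
    rw [this, opGInv_apply, quadraticInv_apply]
    simp only [ha, hb, hc]
    push_cast
    module
  set m := (inner ℂ f (invEnergy f)).re with hm
  have hmI := inner_invEnergy_im f
  have hmn := norm_invEnergy_sq_le f
  rw [← hm] at hmn
  -- Since ⟨f, R f⟩ is real and Re ζ = 1, the rotation leaves the l term unchanged.
  have hre : (inner ℂ f (ζ • T)).re = (inner ℂ f (quadraticInv a b c f)).re + (l - γ / 2) * m
      + (ζ * Complex.I * inner ℂ f (W f)).re := by
    rw [eT, inner_add_right, inner_add_right, inner_smul_right, inner_smul_right, Complex.add_re,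
      Complex.add_re]
    congr 2
    rw [Complex.mul_re, hmI, mul_zero, sub_zero, mul_comm ζ, Complex.re_ofReal_mul]
    simp [hζ, hm]
  have hWre : -(2 * (‖f‖ * ‖W f‖)) ≤ (ζ * Complex.I * inner ℂ f (W f)).re := by
    have h4 := neg_le_of_abs_le (Complex.abs_re_le_norm (ζ * Complex.I * inner ℂ f (W f)))
    rw [norm_mul, norm_mul, Complex.norm_I, mul_one] at h4
    have h5 : ‖ζ‖ * ‖inner ℂ f (W f)‖ ≤ 2 * (‖f‖ * ‖W f‖) := by
      gcongr
      exact norm_inner_le_norm _ _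
    linarith
  have hWf : 2 * (‖f‖ * ‖W f‖) ≤ e / 4 * ‖f‖ ^ 2 + 8 * C ^ 2 / e * ‖invEnergy f‖ ^ 2 := by
    have h6 : ‖f‖ * ‖W f‖ ≤ ‖f‖ * (e / 16 * ‖f‖ + C * ‖invEnergy f‖) := by
      gcongr
      exact hWC f
    have h7 : e / 8 * ‖f‖ ^ 2 + 8 * C ^ 2 / e * ‖invEnergy f‖ ^ 2
        - 2 * (‖f‖ * (C * ‖invEnergy f‖)) = (e * ‖f‖ - 8 * C * ‖invEnergy f‖) ^ 2 / (8 * e) := by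
      field_simp
      ring
    have h8 : 0 ≤ (e * ‖f‖ - 8 * C * ‖invEnergy f‖) ^ 2 / (8 * e) := by positivity
    nlinarith
  have hlow : e / 4 * ‖f‖ ^ 2 ≤ (inner ℂ f (ζ • T)).re := by
    have hm0 : 0 ≤ m := (sq_nonneg _).trans hmn
    have h9 : 8 * C ^ 2 / e * ‖invEnergy f‖ ^ 2 ≤ 8 * C ^ 2 / e * m := by gcongr
    have h10 : (γ / 2 + K + 8 * C ^ 2 / e) * m ≤ l * m := by gcongr
    rw [hre]
    nlinarith
  have hup : (inner ℂ f (ζ • T)).re ≤ 2 * ‖inner ℂ T f‖ := by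
    refine (Complex.re_le_norm _).trans ?_
    rw [inner_smul_right, norm_mul, norm_inner_symm]
    gcongr
  -- Of e / 2 the potential costs e / 4, and ‖ζ‖ ≤ 2 halves the remainder.
  have : ‖f‖ ^ 2 * (e / 8) ≤ ‖inner ℂ T f‖ := by linarith
  exact this

end Generator

end QFP

/-! ### Assembly of the theorem -/

theorem mainTheorem7 (ω Dpp Dpq Dqq γ : ℝ) (V : ℝ → ℝ) (gV α : ℝ)
    (hω : 0 < ω) (hDpp : 0 ≤ Dpp) (hDqq : 0 ≤ Dqq)
    (hΔ : 0 ≤ QFP.lindbladDelta Dpp Dpq Dqq γ)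
    (hV : Differentiable ℝ V) (hV' : Differentiable ℝ (deriv V))
    (hgV : 0 < gV) (hα₀ : 0 ≤ α) (hα₁ : α < 1)
    (hgrowth : ∀ x : ℝ, |deriv V x| ≤ gV * (1 + |x| ^ 2) ^ (α / 2)) :
    (QFP.opG ω Dpp Dpq Dqq γ V).domain = QFP.numberOp.domain ∧
    (0 < Dpp → QFP.lindbladG ω Dpp Dpq Dqq γ V = QFP.opG ω Dpp Dpq Dqq γ V) ∧
    (QFP.opG ω Dpp Dpq Dqq γ V).IsClosed ∧
    ∃ P : ℝ≥0 → QFP.L2R →L[ℂ] QFP.L2R,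
      QFP.IsContractionSemigroup P ∧
      QFP.IsGenerator P (QFP.opG ω Dpp Dpq Dqq γ V) := by
  obtain ⟨b, hb, hVb⟩ := QFP.exists_potential_le hV hgV hα₀ hα₁ hgrowth one_pos
  obtain ⟨W, hW⟩ := QFP.exists_mulOp_invEnergy hV.continuous hb zero_le_one hVb
  have hWε : ∀ ε > 0, ∃ C, 0 ≤ C ∧ ∀ f, ‖W f‖ ≤ ε * ‖f‖ + C * ‖QFP.invEnergy f‖ := by
    intro ε hε
    -- The operator `W` is already fixed by a crude quadratic bound on V. The choice ε / 2
    -- compensates ‖Q² R f‖ ≤ 2 ‖f‖.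
    obtain ⟨C, hC, hVC⟩ := QFP.exists_potential_le hV hgV hα₀ hα₁ hgrowth (half_pos hε)
    refine ⟨C, hC, fun f => ?_⟩
    refine (QFP.norm_le_of_mem_graph_mulOp hC (half_pos hε).le hVC (hW f)).trans ?_
    have := mul_le_mul_of_nonneg_left (QFP.norm_posPosInv_le f) (half_pos hε).le
    linarith
  have hG := QFP.invEnergy_mem_graph_opG (ω := ω) (Dpp := Dpp) (Dpq := Dpq) (Dqq := Dqq) (γ := γ) hW
  have hgraph := QFP.mem_graph_iff_of_domain_le (QFP.opG_domain_le V) hG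
  obtain ⟨l₀, hl₀⟩ := QFP.exists_isUnit_smul_invEnergy_sub (γ := γ) hω hDpp hDqq hΔ hWε
  obtain ⟨P, hP0, hPadd, hPnorm, hPcont, hPgen⟩ := QFP.exists_contraction_semigroup
    QFP.denseRange_invEnergy (QFP.re_inner_opGInv_nonpos hDpp hDqq hΔ hW) hl₀
  refine ⟨?_, fun hpos => ?_, ?_, P, ⟨hP0, hPadd, hPnorm, hPcont⟩, fun u f => ?_⟩
  · refine le_antisymm (QFP.opG_domain_le V) fun u hu => ?_
    obtain ⟨f, rfl⟩ := (QFP.mem_numberOp_domain_iff u).1 hu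
    exact LinearPMap.mem_domain_of_mem_graph (hG f)
  · refine LinearPMap.eq_of_eq_graph (Submodule.ext fun z => ?_)
    exact (QFP.mem_graph_iff_of_domain_le inf_le_left
      (QFP.invEnergy_mem_graph_lindbladG hpos hΔ hW) z.1 z.2).trans (hgraph z.1 z.2).symm
  -- The graph is the set where u equals the resolvent at l₀ applied to l₀ u - v, an equality
  -- between continuous functions of (u, v).
  · have hset : ((QFP.opG ω Dpp Dpq Dqq γ V).graph : Set (QFP.L2R × QFP.L2R))
        = {z | z.1 = QFP.resolventOf QFP.invEnergy (QFP.opGInv ω Dpp Dpq Dqq γ W) l₀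
          (l₀ • z.1 - z.2)} := by
      ext ⟨u, v⟩
      refine (hgraph u v).trans ⟨?_, fun h => ?_⟩
      · rintro ⟨f, rfl, rfl⟩
        exact (QFP.resolventOf_apply_smul_sub (hl₀ l₀ le_rfl) f).symm
      · obtain ⟨w, hw, hw'⟩ := QFP.exists_resolventOf (hl₀ l₀ le_rfl) (l₀ • u - v)
        have hu : QFP.invEnergy w = u := hw'.symm.trans (Eq.symm h)
        refine ⟨w, hu, ?_⟩
        rw [hu] at hw
        exact sub_right_injective hw
    change IsClosed ((QFP.opG ω Dpp Dpq Dqq γ V).graph : Set (QFP.L2R × QFP.L2R))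
    rw [hset]
    exact isClosed_eq (by fun_prop) (by fun_prop)
  · exact (hgraph u f).trans (hPgen u f)
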